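/- **Setting.** Let $d\ge 1$, $k\ge 0$ be integers, $\beta_1\in\mathbb R$, and let $\Omega\subset\mathbb R^d$ be a bounded domain. A rectangular mesh $\mathcal T_h$ of $\Omega$ is a finite set of closed axis-parallel boxes $K$ with nonempty, pairwise disjoint interiors such that $\Omega$ is the interior of $\bigcup_K K$. Let $\partial\Omega_D\subset\partial\Omega$ and $\partial\Omega_N=\partial\Omega\setminus\partial\Omega_D$; the mesh resolves $\partial\Omega_D$ if $\partial\Omega_D$ is a union of closed faces of cells. Let $\Gamma^0$ be the set of interior interfaces $e=K_1\cap K_2$ (of dimension $d-1$), with unit normal $n$ (along a coordinate axis) oriented from $K_1$ to $K_2$, $[w]=w|_{K_2}-w|_{K_1}$ and $\{w\}=\frac12(w|_{K_1}+w|_{K_2})$ on $e$. Let $h_e$ be the average of the widths of $K_1,K_2$ in direction $n$ (on a boundary face, the width of the cell in normal direction), and let $\mathbf n$ be the exterior unit normal on $\partial\Omega$. For $\kappa\in\mathbb R$ we say that the mesh has ratio bound $\kappa$ if for any two cells sharing an interface, each of their two widths in the direction normal to it is at most $\kappa$ times the other. Let $V_h$ be the space of functions that on each cell are polynomials of total degree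 at most $k$, and $\|\cdot\|$ the $L^2(\Omega)$ norm. For charges $q_1,\dots,q_m\in\mathbb R$, integrable data $\rho_0$ on $\Omega$, $\psi_D$ on $\partial\Omega_D$, $\sigma$ on $\partial\Omega_N$, and $c_{1h},\dots,c_{mh}\in V_h$, the DDG scheme for $-\Delta\psi=\sum_i q_ic_i+\rho_0$, $\psi=\psi_D$ on $\partial\Omega_D$, $\partial_{\mathbf n}\psi=\sigma$ on $\partial\Omega_N$, is: find $\psi_h\in V_h$ with $$A(\psi_h,\eta)=L(c_{ih},\eta)\qquad\forall\eta\in V_h,$$ where, with $\widehat{\partial_n w}=\beta_0\frac{[w]}{h_e}+\{\partial_n w\}+\beta_1h_e[\partial_n^2w]$, $$A(\psi,\eta)=\sum_K\int_K\nabla\psi\cdot\nabla\eta\,dx+\sum_{e\in\Gamma^0}\int_e\big(\widehat{\partial_n\psi}[\eta]+\{\partial_n\eta\}[\psi]\big)ds+\int_{\partial\Omega_D}\Big(\big(\tfrac{\beta_0}{h_e}\psi-\partial_{\mathbf n}\psi\big)\eta-\psi\,\partial_{\mathbf n}\eta\Big)ds,$$ $$L(c_{ih},\eta)=\sum_K\int_K\Big(\sum_{i=1}^mq_ic_{ih}+\rho_0\Big)\eta\,dx+\int_{\partial\Omega_D}\big(\tfrac{\beta_0}{h_e}\eta-\partial_{\mathbf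 n}\eta\big)\psi_D\,ds+\int_{\partial\Omega_N}\sigma\eta\,ds.$$ **Theorem 3.2.** For all $d,k,\beta_1,\kappa$ there is a number $\beta_0^*>1$, depending only on these, such that the following holds; moreover, for $\kappa=1$ (uniform meshes), $d\le 2$ and $k\ge1$ one may take $\beta_0^*=\max\{\Gamma(\beta_1),2\Gamma(0)\}$ with $\Gamma(\beta_1)=k^2\big(1-\beta_1(k^2-1)+\frac{\beta_1^2}{3}(k^2-1)^2\big)$. Let $\beta_0>\beta_0^*$, let $\Omega$ be a bounded domain and let $\partial\Omega_D\subset\partial\Omega$ with $\partial\Omega_D\neq\emptyset$. Then there is a constant $C>0$ such that for every rectangular mesh $\mathcal T_h$ of $\Omega$ with ratio bound $\kappa$ that resolves $\partial\Omega_D$, and for all $m$, $q_i$, $\rho_0$, $\psi_D$, $\sigma$ as above: 1. for given $c_{ih}\in V_h$ ($i=1,\dots,m$) the DDG scheme has a unique solution $\psi_h\in V_h$; 2. if $\psi_h$ and $\tilde\psi_h$ are the solutions for $c_{ih}$ and $\tilde c_{ih}$ respectively, then $$\|\psi_h-\tilde\psi_h\|\le C\sum_{i=1}^m|q_i|\,\|c_{ih}-\tilde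 c_{ih}\|.$$ In particular, $C$ is independent of the mesh and of the mesh size $h$. -/

import Mathlib

open MeasureTheory

/-! The direct discontinuous Galerkin (DDG) method for the Poisson equation on rectangular meshes of
a domain in `ℝ^d`, `d = n + 1`. -/

noncomputable section

namespace DDG

open BoxIntegral

/-- A mesh of `Ω ⊆ ℝ^(n+1)` by finitely many nondegenerate axis-parallel closed boxes with pairwise
disjoint interiors, whose union has interior `Ω`. Neighbouring cells need not share a full face. -/
structure RectMesh {n : ℕ} (Ω : Set (Fin (n + 1) → ℝ)) where
  numCells : ℕ
  cell : Fin numCells → Box (Fin (n + 1))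
  interior_union : Ω = interior (⋃ K, Box.Icc (cell K))
  disjoint_cells : ∀ K K', K ≠ K' → Disjoint (Box.Ioo (cell K)) (Box.Ioo (cell K'))

/-- Side length of a box in direction `j`. -/
def width {n : ℕ} (B : Box (Fin (n + 1))) (j : Fin (n + 1)) : ℝ := B.upper j - B.lower j

/-- The `j`-th coordinate of the upper (`s = true`) or lower (`s = false`) face orthogonal to the
`j`-th axis. -/
def faceCoord {n : ℕ} (B : Box (Fin (n + 1))) (j : Fin (n + 1)) (s : Bool) : ℝ :=
  if s then B.upper j else B.lower j

/-- The point of the hyperplane `x_j = faceCoord B j s` with remaining coordinates `y`. -/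
def facePoint {n : ℕ} (B : Box (Fin (n + 1))) (j : Fin (n + 1)) (s : Bool) (y : Fin n → ℝ) :
    Fin (n + 1) → ℝ :=
  j.insertNth (faceCoord B j s) y

/-- The closed face of `B` orthogonal to the `j`-th axis, on the side `s`. -/
def closedFace {n : ℕ} (B : Box (Fin (n + 1))) (j : Fin (n + 1)) (s : Bool) :
    Set (Fin (n + 1) → ℝ) :=
  facePoint B j s '' Box.Icc (B.face j)

/-- The `j`-th component of the exterior unit normal on the face `(j, s)`. -/
def normalSign (s : Bool) : ℝ := if s then 1 else -1

/-- `K₁` and `K₂` share an interface with normal `e_j` pointing from `K₁` to `K₂`. -/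
def Adjacent {n : ℕ} (K₁ K₂ : Box (Fin (n + 1))) (j : Fin (n + 1)) : Prop :=
  K₁.upper j = K₂.lower j ∧ (Box.Ioo (K₁.face j) ∩ Box.Ioo (K₂.face j)).Nonempty

namespace RectMesh

variable {n : ℕ} {Ω : Set (Fin (n + 1) → ℝ)}

/-- The widths, in normal direction, of any two cells that share an interface differ at most by the
factor `κ`. For `κ = 1` the mesh is uniform. -/
def RatioBound (T : RectMesh Ω) (κ : ℝ) : Prop :=
  ∀ K₁ K₂ j, Adjacent (T.cell K₁) (T.cell K₂) j →
    width (T.cell K₁) j ≤ κ * width (T.cell K₂) j ∧ width (T.cell K₂) j ≤ κ * width (T.cell K₁) j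

/-- The boundary part `Γ` is a union of faces of the mesh. -/
def Resolves (T : RectMesh Ω) (Γ : Set (Fin (n + 1) → ℝ)) : Prop :=
  ∀ x ∈ Γ, ∃ K j s, x ∈ closedFace (T.cell K) j s ∧ closedFace (T.cell K) j s ⊆ Γ

/-- The space `V_h`: a polynomial of total degree at most `k` on each cell, independently. -/
abbrev Space (T : RectMesh Ω) (k : ℕ) : Type :=
  Fin T.numCells → MvPolynomial.restrictTotalDegree (Fin (n + 1)) ℝ k

variable {T : RectMesh Ω} {k : ℕ}

/-- Value at `x` of the polynomial that represents `v` on the cell `K`. -/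
def val (v : T.Space k) (K : Fin T.numCells) (x : Fin (n + 1) → ℝ) : ℝ :=
  MvPolynomial.eval x (v K : MvPolynomial (Fin (n + 1)) ℝ)

/-- `∂_j v` on the cell `K`. -/
def d1 (v : T.Space k) (K : Fin T.numCells) (j : Fin (n + 1)) (x : Fin (n + 1) → ℝ) : ℝ :=
  MvPolynomial.eval x (MvPolynomial.pderiv j (v K : MvPolynomial (Fin (n + 1)) ℝ))

/-- `∂_j² v` on the cell `K`. -/
def d2 (v : T.Space k) (K : Fin T.numCells) (j : Fin (n + 1)) (x : Fin (n + 1) → ℝ) : ℝ :=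
  MvPolynomial.eval x
    (MvPolynomial.pderiv j (MvPolynomial.pderiv j (v K : MvPolynomial (Fin (n + 1)) ℝ)))

/-- The `L²(Ω)` norm on `V_h`. -/
def l2norm (v : T.Space k) : ℝ :=
  Real.sqrt (∑ K, ∫ x in Box.Icc (T.cell K), val v K x ^ 2)

/-- The mean of the normal widths of the two cells at an interface. -/
def hInterface (T : RectMesh Ω) (K₁ K₂ : Fin T.numCells) (j : Fin (n + 1)) : ℝ :=
  (width (T.cell K₁) j + width (T.cell K₂) j) / 2

/-- `[v]` at an interface. -/
def jump (v : T.Space k) (K₁ K₂ : Fin T.numCells) (x : Fin (n + 1) → ℝ) : ℝ :=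
  val v K₂ x - val v K₁ x

/-- `{∂_n v}` at an interface with normal `n = e_j`. -/
def avgD1 (v : T.Space k) (K₁ K₂ : Fin T.numCells) (j : Fin (n + 1)) (x : Fin (n + 1) → ℝ) : ℝ :=
  (d1 v K₁ j x + d1 v K₂ j x) / 2

/-- `[∂_n² v]` at an interface with normal `n = e_j`. -/
def jumpD2 (v : T.Space k) (K₁ K₂ : Fin T.numCells) (j : Fin (n + 1)) (x : Fin (n + 1) → ℝ) : ℝ :=
  d2 v K₂ j x - d2 v K₁ j x

/-- The numerical flux `β₀ [v] / h_e + {∂_n v} + β₁ h_e [∂_n² v]` at an interface. -/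
def flux (β₀ β₁ : ℝ) (v : T.Space k) (K₁ K₂ : Fin T.numCells) (j : Fin (n + 1))
    (x : Fin (n + 1) → ℝ) : ℝ :=
  β₀ * jump v K₁ K₂ x / T.hInterface K₁ K₂ j + avgD1 v K₁ K₂ j x
    + β₁ * T.hInterface K₁ K₂ j * jumpD2 v K₁ K₂ j x

open Classical in
/-- `∑_{e ∈ Γ⁰} ∫_e f ds`. Each interface is listed once, with its normal in the positive direction
of a coordinate axis; the integrands used below do not depend on the orientation. -/
def interfaceIntegral (T : RectMesh Ω)
    (f : Fin T.numCells → Fin T.numCells → Fin (n + 1) → (Fin (n + 1) → ℝ) → ℝ) : ℝ :=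
  ∑ j, ∑ K₁, ∑ K₂,
    if Adjacent (T.cell K₁) (T.cell K₂) j then
      ∫ y in Box.Icc ((T.cell K₁).face j) ∩ Box.Icc ((T.cell K₂).face j),
        f K₁ K₂ j (facePoint (T.cell K₁) j true y)
    else 0

/-- Parameters `y` of the points of the face `(j, s)` of the cell `K` that lie in `Γ`. -/
def faceIn (T : RectMesh Ω) (Γ : Set (Fin (n + 1) → ℝ)) (K : Fin T.numCells) (j : Fin (n + 1))
    (s : Bool) : Set (Fin n → ℝ) :=
  Box.Icc ((T.cell K).face j) ∩ {y | facePoint (T.cell K) j s y ∈ Γ}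

/-- `∫_Γ f ds` for a part `Γ` of the boundary of `Ω`. -/
def boundaryIntegral (T : RectMesh Ω) (Γ : Set (Fin (n + 1) → ℝ))
    (f : Fin T.numCells → Fin (n + 1) → Bool → (Fin (n + 1) → ℝ) → ℝ) : ℝ :=
  ∑ K, ∑ j, ∑ s, ∫ y in T.faceIn Γ K j s, f K j s (facePoint (T.cell K) j s y)

/-- `g` is integrable on the part `Γ` of the boundary of `Ω`. -/
def BoundaryIntegrable (T : RectMesh Ω) (Γ : Set (Fin (n + 1) → ℝ)) (g : (Fin (n + 1) → ℝ) → ℝ) :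
    Prop :=
  ∀ K j s, IntegrableOn (fun y => g (facePoint (T.cell K) j s y)) (T.faceIn Γ K j s)

/-- The bilinear form `A(ψ, η)`, with Dirichlet part `ΓD` of the boundary. -/
def formA (ΓD : Set (Fin (n + 1) → ℝ)) (β₀ β₁ : ℝ) (ψ η : T.Space k) : ℝ :=
  (∑ K, ∫ x in Box.Icc (T.cell K), ∑ j, d1 ψ K j x * d1 η K j x)
  + T.interfaceIntegral (fun K₁ K₂ j x =>
      flux β₀ β₁ ψ K₁ K₂ j x * jump η K₁ K₂ x + avgD1 η K₁ K₂ j x * jump ψ K₁ K₂ x)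
  + T.boundaryIntegral ΓD (fun K j s x =>
      (β₀ / width (T.cell K) j * val ψ K x - normalSign s * d1 ψ K j x) * val η K x
        - val ψ K x * (normalSign s * d1 η K j x))

/-- The functional `L(c, η)`, with charges `q`, source `ρ₀`, Dirichlet data `ψD` on `ΓD` and Neumann
data `σ` on `∂Ω \ ΓD`. -/
def formL (ΓD : Set (Fin (n + 1) → ℝ)) (β₀ : ℝ) {m : ℕ} (q : Fin m → ℝ)
    (ρ₀ ψD σ : (Fin (n + 1) → ℝ) → ℝ) (c : Fin m → T.Space k) (η : T.Space k) : ℝ :=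
  (∑ K, ∫ x in Box.Icc (T.cell K), ((∑ i, q i * val (c i) K x) + ρ₀ x) * val η K x)
  + T.boundaryIntegral ΓD (fun K j s x =>
      (β₀ / width (T.cell K) j * val η K x - normalSign s * d1 η K j x) * ψD x)
  + T.boundaryIntegral (frontier Ω \ ΓD) (fun K _ _ x => σ x * val η K x)

/-- `ψ ∈ V_h` solves the DDG scheme `A(ψ, η) = L(c, η)` for all `η ∈ V_h`. -/
def IsSolution (ΓD : Set (Fin (n + 1) → ℝ)) (β₀ β₁ : ℝ) {m : ℕ} (q : Fin m → ℝ)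
    (ρ₀ ψD σ : (Fin (n + 1) → ℝ) → ℝ) (c : Fin m → T.Space k) (ψ : T.Space k) : Prop :=
  ∀ η : T.Space k, formA ΓD β₀ β₁ ψ η = formL ΓD β₀ q ρ₀ ψD σ c η

end RectMesh

/-- `k² (1 - β₁ (k² - 1) + β₁² (k² - 1)² / 3)`. -/
def Gam (k : ℕ) (β₁ : ℝ) : ℝ :=
  (k : ℝ) ^ 2 * (1 - β₁ * ((k : ℝ) ^ 2 - 1) + β₁ ^ 2 / 3 * ((k : ℝ) ^ 2 - 1) ^ 2)

end DDG

end

noncomputable section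
namespace DDG

open Polynomial

/-! ### A sharp trace inequality for polynomials -/

/-! The proof bounds `formA` from below by a mesh-dependent energy (broken gradient, jumps over
`h_e`, Dirichlet traces over the width) and bounds the `L²` norm by this energy with a constant
independent of the mesh. Solvability and stability then follow as in the Lax–Milgram argument.

Coercivity is one-dimensional. By Fubini, both `formA` on the diagonal and the energy are sums over
directions `j` of integrals over lines parallel to the `j`-th axis
(`meshSum_eq_sum_integral_lineSum`), and almost every line avoids the lateral faces of the cells. On
a line, the terms of indefinite sign are a jump times endpoint values of `p ± β₁ h p'`, where `p` is
the derivative of the solution on a cell and has degree below `k`. Expansion in shifted Legendre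
polynomials gives the sharp constant `Gam k c` in `w (p ± c w p')² ≤ Gam k c ∫ p²` at an endpoint
(`sq_eval_zero_le`). Young's inequality with a weight strictly between the threshold and `β₀`
absorbs these terms. Since each end of a cell is charged at most once (`sum_lineAdjacent_le`), a
positive share of the gradient and of the jumps survives (`lineForm_ge`).

The Poincaré–Friedrichs inequality (`exists_poincare`) also uses lines. Walking through the cells
met by a segment inside `Ω`, the Cauchy–Schwarz inequality bounds the change of the function by the
energy of the line, uniformly in the mesh, because both the widths and the numbers `h_e` on a line
sum to at most the diameter bound `2R` (`sq_line_sub_le`). This controls the `L²` norm on one box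
with a Dirichlet face, then spreads the control from a subbox to a box in `Ω` one coordinate at a
time, and by connectedness to a cube around every point of `Ω`. The cells of one fixed mesh serve as
a finite cover, so the constant does not depend on the mesh on which the function lives. -/

theorem intervalIntegrable_eval (p : ℝ[X]) (a b : ℝ) :
    IntervalIntegrable (fun x => p.eval x) volume a b :=
  p.continuous.intervalIntegrable a b

theorem integral_derivative_eval (p : ℝ[X]) (a b : ℝ) :
    ∫ x in a..b, (derivative p).eval x = p.eval b - p.eval a :=
  intervalIntegral.integral_eq_sub_of_hasDerivAt (fun x _ => p.hasDerivAt x)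
    (intervalIntegrable_eval _ a b)

/-- Integration over `[0, 1]` as a linear functional on polynomials. -/
def unitIntegral : ℝ[X] →ₗ[ℝ] ℝ where
  toFun p := ∫ x in (0 : ℝ)..1, p.eval x
  map_add' p q := by
    simp only [eval_add]
    exact intervalIntegral.integral_add (intervalIntegrable_eval _ _ _)
      (intervalIntegrable_eval _ _ _)
  map_smul' c p := by simp

theorem unitIntegral_apply (p : ℝ[X]) : unitIntegral p = ∫ x in (0 : ℝ)..1, p.eval x := rfl

theorem unitIntegral_derivative (p : ℝ[X]) :
    unitIntegral (derivative p) = p.eval 1 - p.eval 0 := integral_derivative_eval p 0 1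

theorem unitIntegral_mul_self_nonneg (p : ℝ[X]) : 0 ≤ unitIntegral (p * p) := by
  rw [unitIntegral_apply]
  refine intervalIntegral.integral_nonneg zero_le_one fun x _ => ?_
  rw [eval_mul]
  exact mul_self_nonneg _

/-! ### Shifted Legendre polynomials: orthogonality, norm and endpoint values. -/

/-- The shifted Legendre polynomial with real coefficients. -/
def legendre (m : ℕ) : ℝ[X] := (shiftedLegendre m).map (Int.castRingHom ℝ)

theorem natDegree_legendre (m : ℕ) : (legendre m).natDegree = m := by
  rw [legendre, natDegree_map_eq_of_injective (RingHom.injective_int _), natDegree_shiftedLegendre]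

theorem eval_zero_legendre (m : ℕ) : (legendre m).eval 0 = 1 := by
  rw [← coeff_zero_eq_eval_zero, legendre, coeff_map, coeff_shiftedLegendre]
  simp

theorem eval_zero_derivative_legendre (m : ℕ) :
    (derivative (legendre m)).eval 0 = -((m : ℝ) * (m + 1)) := by
  rw [← coeff_zero_eq_eval_zero, coeff_derivative, legendre, coeff_map, coeff_shiftedLegendre]
  simp

/-- Rodrigues' formula, which reduces orthogonality to `m` integrations by parts. -/
theorem factorial_mul_legendre (m : ℕ) :
    C (m.factorial : ℝ) * legendre m = derivative^[m] (X ^ m * (1 - X) ^ m) := by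
  have h := congrArg (Polynomial.map (Int.castRingHom ℝ)) (factorial_mul_shiftedLegendre_eq m)
  rw [← iterate_derivative_map] at h
  simpa [legendre] using h

theorem unitIntegral_iterate_derivative_mul (m j : ℕ) (hj : j ≤ m) (q : ℝ[X]) :
    unitIntegral (derivative^[j] (X ^ m * (1 - X) ^ m) * q)
      = (-1) ^ j * unitIntegral (X ^ m * (1 - X) ^ m * derivative^[j] q) := by
  induction j generalizing q with
  | zero => simp
  | succ j ih =>
    set f : ℝ[X] := X ^ m * (1 - X) ^ m with hf
    -- As `j < m`, a `j`-fold derivative keeps at least one factor `X` and one factor `1 - X`, so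
    -- the boundary terms vanish at both endpoints.
    have hroot : ∀ p : ℝ[X], p ^ m ∣ f → p ∣ derivative^[j] f := fun p hp =>
      (dvd_pow_self p (by omega)).trans (pow_sub_dvd_iterate_derivative_of_pow_dvd j hp)
    have h0 : (derivative^[j] f).eval 0 = 0 :=
      eval_eq_zero_of_dvd_of_eval_eq_zero (hroot X ⟨_, hf⟩) (by simp)
    have h1 : (derivative^[j] f).eval 1 = 0 :=
      eval_eq_zero_of_dvd_of_eval_eq_zero (hroot (1 - X) ⟨X ^ m, by rw [hf, mul_comm]⟩) (by simp)
    have hparts := unitIntegral_derivative (derivative^[j] f * q)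
    rw [derivative_mul, map_add, eval_mul, eval_mul, h0, h1] at hparts
    rw [Function.iterate_succ_apply', Function.iterate_succ_apply]
    have := ih (by omega) (derivative q)
    rw [pow_succ]
    linarith

theorem unitIntegral_legendre_mul {m : ℕ} {q : ℝ[X]} (hq : q.degree < m) :
    unitIntegral (legendre m * q) = 0 := by
  have hD : derivative^[m] q = 0 := iterate_derivative_eq_zero_of_degree_lt hq
  have h := unitIntegral_iterate_derivative_mul m m le_rfl q
  rw [hD, mul_zero, map_zero, mul_zero, ← factorial_mul_legendre, mul_assoc, ← smul_eq_C_mul,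
    map_smul, smul_eq_mul] at h
  exact (mul_eq_zero.mp h).resolve_left (by exact_mod_cast m.factorial_ne_zero)

theorem degree_sub_C_mul_legendre_lt {m : ℕ} {q : ℝ[X]} (hq : q.natDegree ≤ m) :
    (q - C (q.coeff m / (legendre m).coeff m) * legendre m).degree < m := by
  have hlead : (legendre m).coeff m ≠ 0 := by
    have h : (legendre m).leadingCoeff ≠ 0 := by
      rw [leadingCoeff_ne_zero]
      intro h
      simpa [h] using eval_zero_legendre m
    rwa [leadingCoeff, natDegree_legendre] at h
  rw [degree_lt_iff_coeff_zero]
  intro i hi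
  rcases hi.eq_or_lt with rfl | hi
  · simp [hlead]
  · rw [coeff_sub, coeff_C_mul, coeff_eq_zero_of_natDegree_lt (hq.trans_lt hi),
      coeff_eq_zero_of_natDegree_lt ((natDegree_legendre m).trans_lt hi)]
    simp

/-- Integrate the derivative of `(X - 1) P²` with `P = legendre m`: the boundary terms give `P(0)² =
1`. On the other side, `(X - 1) P'` equals `m P` up to lower degree, which is orthogonal to `P`, so
the integral is `(1 + 2m) ∫ P²`. -/
theorem unitIntegral_legendre_mul_self (m : ℕ) :
    (2 * (m : ℝ) + 1) * unitIntegral (legendre m * legendre m) = 1 := by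
  have hparts := unitIntegral_derivative ((X - 1) * (legendre m * legendre m))
  have hdeg : ((X - 1) * derivative (legendre m) - C (m : ℝ) * legendre m).degree
      < (m : WithBot ℕ) := by
    rw [degree_lt_iff_coeff_zero]
    intro i hi
    have hc : ∀ j, m < j → (legendre m).coeff j = 0 := fun j hj =>
      coeff_eq_zero_of_natDegree_lt (by rwa [natDegree_legendre])
    rw [coeff_sub, coeff_C_mul, sub_mul, coeff_sub, one_mul, coeff_derivative, hc (i + 1) (by omega)]
    rcases i with _ | i
    · obtain rfl : m = 0 := by omega
      simp
    · rw [coeff_X_mul, coeff_derivative]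
      rcases hi.eq_or_lt with h | h
      · rw [h]; push_cast; ring
      · rw [hc _ h]; simp
  have horth := unitIntegral_legendre_mul hdeg
  rw [mul_sub, map_sub, mul_left_comm _ (C _), ← smul_eq_C_mul, map_smul, smul_eq_mul] at horth
  have hexp : derivative ((X - 1) * (legendre m * legendre m)) = legendre m * legendre m
      + (2 : ℝ) • (legendre m * ((X - 1) * derivative (legendre m))) := by
    simp only [derivative_mul, derivative_sub, derivative_X, derivative_one, smul_eq_C_mul, map_ofNat]
    ring
  rw [hexp, map_add, map_smul, smul_eq_mul] at hparts
  simp only [eval_mul, eval_sub, eval_X, eval_one, eval_zero_legendre] at hparts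
  linarith

/-- The increment is the square of `P + c P'` at `0` divided by `∫ P²`, for `P = legendre m`. Thus
`Gam k c` is the squared norm of the functional `q ↦ q(0) + c q'(0)` on polynomials of degree below
`k`. -/
theorem Gam_succ (m : ℕ) (c : ℝ) :
    Gam (m + 1) c = Gam m c + (2 * (m : ℝ) + 1) * (1 - c * ((m : ℝ) * (m + 1))) ^ 2 := by
  simp only [Gam]
  push_cast
  ring

theorem Gam_nonneg (m : ℕ) (c : ℝ) : 0 ≤ Gam m c := by
  induction m with
  | zero => simp [Gam]
  | succ m ih => rw [Gam_succ]; positivity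

/-- A two-term Cauchy–Schwarz inequality: since `N v = 1`, also `y² = (N F²)(a² v)`. It adds one
Legendre mode to the trace bound. -/
theorem sq_add_le_of_weights {x y u v a G N F : ℝ} (hx : x ^ 2 ≤ G * u) (hu : 0 ≤ u) (hG : 0 ≤ G)
    (hN : 0 ≤ N) (hv : N * v = 1) (hy : y = a * F) :
    (x + y) ^ 2 ≤ (G + N * F ^ 2) * (u + a ^ 2 * v) := by
  subst hy
  have hN0 : 0 < N := lt_of_le_of_ne hN fun h => by simp [← h] at hv
  have hv0 : v = N⁻¹ := eq_inv_of_mul_eq_one_right hv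
  have hcross : 2 * x * (a * F) ≤ G * (a ^ 2 * v) + N * F ^ 2 * u := by
    have h : (x * (a * F)) ^ 2 ≤ (G * (a ^ 2 * v)) * (N * F ^ 2 * u) := by
      calc (x * (a * F)) ^ 2 = x ^ 2 * (a * F) ^ 2 := by ring
        _ ≤ G * u * (a * F) ^ 2 := by gcongr
        _ = G * u * (a * F) ^ 2 * (N * v) := by rw [hv, mul_one]
        _ = _ := by ring
    have hp : 0 ≤ G * (a ^ 2 * v) := by rw [hv0]; positivity
    have hq : 0 ≤ N * F ^ 2 * u := by positivity
    have habs := abs_le_of_sq_le_sq (a := 2 * (x * (a * F)))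
      (b := G * (a ^ 2 * v) + N * F ^ 2 * u)
      (by nlinarith [sq_nonneg (G * (a ^ 2 * v) - N * F ^ 2 * u)]) (by positivity)
    linarith [le_of_abs_le habs]
  calc (x + a * F) ^ 2 = x ^ 2 + 2 * x * (a * F) + a ^ 2 * F ^ 2 * (N * v) := by rw [hv]; ring
    _ ≤ G * u + (G * (a ^ 2 * v) + N * F ^ 2 * u) + a ^ 2 * F ^ 2 * (N * v) := by gcongr
    _ = _ := by ring

/-- Induction on the degree: split off the component along the top Legendre polynomial, which is
orthogonal to the remainder, and add its contribution to both factors. -/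
theorem sq_eval_zero_le (c : ℝ) (k : ℕ) (q : ℝ[X]) (hq : q.degree < k) :
    (q.eval 0 + c * (derivative q).eval 0) ^ 2 ≤ Gam k c * unitIntegral (q * q) := by
  induction k generalizing q with
  | zero =>
    have : q = 0 := by simpa using hq
    simp [this]
  | succ m ih =>
    set a : ℝ := q.coeff m / (legendre m).coeff m
    set r : ℝ[X] := q - C a * legendre m with hr
    have hrdeg : r.degree < m := degree_sub_C_mul_legendre_lt (natDegree_le_iff_degree_le.mpr
      (Order.lt_succ_iff.mp (by exact_mod_cast hq)))
    have hqr : q = r + C a * legendre m := by rw [hr]; ring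
    have horth := unitIntegral_legendre_mul hrdeg
    have hnorm : unitIntegral (q * q)
        = unitIntegral (r * r) + a ^ 2 * unitIntegral (legendre m * legendre m) := by
      have hexp : q * q = r * r + (2 * a) • (legendre m * r)
          + (a ^ 2) • (legendre m * legendre m) := by
        rw [hqr]
        simp only [smul_eq_C_mul, map_mul, map_pow, map_ofNat]
        ring
      rw [hexp, map_add, map_add, map_smul, map_smul, horth]
      simp
    have hval : q.eval 0 + c * (derivative q).eval 0 = (r.eval 0 + c * (derivative r).eval 0)
        + a * (1 - c * ((m : ℝ) * (m + 1))) := by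
      rw [hqr]
      simp only [eval_add, eval_mul, eval_C, derivative_add, derivative_mul, derivative_C, eval_zero,
        eval_zero_legendre, eval_zero_derivative_legendre]
      ring
    rw [hval, hnorm, Gam_succ]
    exact sq_add_le_of_weights (ih r hrdeg) (unitIntegral_mul_self_nonneg r) (Gam_nonneg m c)
      (by positivity) (unitIntegral_legendre_mul_self m) rfl

theorem unitIntegral_comp_mul_self (p : ℝ[X]) (a h : ℝ) (hh : h ≠ 0) :
    h * unitIntegral (p.comp (C a + C h * X) * p.comp (C a + C h * X))
      = ∫ x in a..a + h, p.eval x ^ 2 := by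
  have := intervalIntegral.integral_comp_mul_add (a := 0) (b := 1) (fun x => p.eval x ^ 2) hh a
  simp only [mul_zero, mul_one, zero_add, smul_eq_mul] at this
  rw [add_comm a h, ← mul_inv_cancel_left₀ hh (∫ x in a..h + a, p.eval x ^ 2), ← this,
    unitIntegral_apply]
  congr 2
  ext x
  simp [sq, add_comm]

theorem degree_comp_affine_lt {p : ℝ[X]} {k : ℕ} (hp : p.degree < k) (a h : ℝ) :
    (p.comp (C a + C h * X)).degree < k := by
  rcases eq_or_ne p 0 with rfl | h0
  · simp
  rcases eq_or_ne (p.comp (C a + C h * X)) 0 with h1 | h1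
  · rw [h1, degree_zero]; exact WithBot.bot_lt_coe k
  rw [← natDegree_lt_iff_degree_lt h1]
  rw [← natDegree_lt_iff_degree_lt h0] at hp
  refine lt_of_le_of_lt ?_ hp
  refine natDegree_comp_le.trans ?_
  have : (C a + C h * X : ℝ[X]).natDegree ≤ 1 := by compute_degree
  exact (Nat.mul_le_mul_left _ this).trans (by simp)

/-- The length `h` may be negative, so that the bound at `0` serves both endpoints of an interval;
the extra factor `h` on each side makes the inequality insensitive to its sign. -/
theorem mul_sq_endpoint_le {p : ℝ[X]} {k : ℕ} (hp : p.degree < k) (c e h : ℝ) (hh : h ≠ 0) :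
    (p.eval e + c * (h * (derivative p).eval e)) ^ 2 * h ^ 2
      ≤ Gam k c * (h * ∫ x in e..e + h, p.eval x ^ 2) := by
  have hz := sq_eval_zero_le c k _ (degree_comp_affine_lt hp e h)
  simp only [eval_comp, derivative_comp, eval_add, eval_mul, eval_C, eval_X, mul_zero, add_zero,
    derivative_add, derivative_mul, derivative_C, derivative_X, zero_mul, mul_one, zero_add] at hz
  rw [← unitIntegral_comp_mul_self p e h hh]
  calc _ ≤ Gam k c * unitIntegral (p.comp (C e + C h * X) * p.comp (C e + C h * X)) * h ^ 2 := by
        gcongr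
    _ = _ := by ring

/-- With `c = 0` this is the sharp trace inequality at the left endpoint. -/
theorem width_mul_sq_left_le {p : ℝ[X]} {k : ℕ} (hp : p.degree < k) (c : ℝ) {a b : ℝ}
    (hab : a < b) :
    (b - a) * (p.eval a + c * ((b - a) * (derivative p).eval a)) ^ 2
      ≤ Gam k c * ∫ x in a..b, p.eval x ^ 2 := by
  have hh : 0 < b - a := sub_pos.mpr hab
  have h := mul_sq_endpoint_le hp c a (b - a) hh.ne'
  rw [add_sub_cancel] at h
  refine le_of_mul_le_mul_left ?_ hh
  linarith

theorem width_mul_sq_right_le {p : ℝ[X]} {k : ℕ} (hp : p.degree < k) (c : ℝ) {a b : ℝ}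
    (hab : a < b) :
    (b - a) * (p.eval b - c * ((b - a) * (derivative p).eval b)) ^ 2
      ≤ Gam k c * ∫ x in a..b, p.eval x ^ 2 := by
  have hh : 0 < b - a := sub_pos.mpr hab
  -- The interval is traversed backwards from `b`, which reverses the sign in front of `c`.
  have h := mul_sq_endpoint_le hp c b (a - b) (by linarith)
  rw [add_sub_cancel, intervalIntegral.integral_symm] at h
  refine le_of_mul_le_mul_left ?_ hh
  have e : (p.eval b + c * ((a - b) * (derivative p).eval b)) ^ 2 * (a - b) ^ 2
      = (b - a) * ((b - a) * (p.eval b - c * ((b - a) * (derivative p).eval b)) ^ 2) := by ring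
  rw [e] at h
  linarith

open BoxIntegral

/-! ### Restriction of polynomials to coordinate lines -/

section Lines

variable {n : ℕ}

/-- Restriction of a polynomial to the line in direction `j` through `y`. -/
def linePoly (j : Fin (n + 1)) (y : Fin n → ℝ) : MvPolynomial (Fin (n + 1)) ℝ →ₐ[ℝ] ℝ[X] :=
  MvPolynomial.aeval (j.insertNth X (fun i => C (y i)) : Fin (n + 1) → ℝ[X])

theorem eval_linePoly (j : Fin (n + 1)) (y : Fin n → ℝ) (t : ℝ)
    (P : MvPolynomial (Fin (n + 1)) ℝ) :
    (linePoly j y P).eval t = MvPolynomial.eval (j.insertNth t y : Fin (n + 1) → ℝ) P := by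
  rw [linePoly, ← coe_evalRingHom, MvPolynomial.aeval_def, MvPolynomial.hom_eval₂]
  have h1 : (evalRingHom t).comp (algebraMap ℝ ℝ[X]) = RingHom.id ℝ := by
    ext; simp
  have h2 : (evalRingHom t ∘ (j.insertNth X (fun i => C (y i)) : Fin (n + 1) → ℝ[X]))
      = j.insertNth t y := by
    funext i
    refine j.succAboveCases ?_ (fun i => ?_) i <;> simp
  rw [h1]
  change MvPolynomial.eval₂ (RingHom.id ℝ) (evalRingHom t ∘ _) P = _
  rw [h2]
  rfl

theorem derivative_linePoly (j : Fin (n + 1)) (y : Fin n → ℝ) (P : MvPolynomial (Fin (n + 1)) ℝ) :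
    derivative (linePoly j y P) = linePoly j y (MvPolynomial.pderiv j P) := by
  induction P using MvPolynomial.induction_on with
  | C a => simp
  | add p q hp hq => simp [hp, hq]
  | mul_X p i hp =>
    have hX : derivative (linePoly j y (MvPolynomial.X i))
        = linePoly j y (MvPolynomial.pderiv j (MvPolynomial.X i)) := by
      refine j.succAboveCases ?_ (fun i => ?_) i
      · simp [linePoly]
      · rw [MvPolynomial.pderiv_X_of_ne (Fin.succAbove_ne j i)]
        simp [linePoly]
    rw [map_mul, derivative_mul, hp, hX, Derivation.leibniz, map_add, smul_eq_mul, smul_eq_mul,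
      map_mul, map_mul]
    ring

theorem natDegree_linePoly_le (j : Fin (n + 1)) (y : Fin n → ℝ) {k : ℕ}
    (P : MvPolynomial.restrictTotalDegree (Fin (n + 1)) ℝ k) :
    (linePoly j y (P : MvPolynomial (Fin (n + 1)) ℝ)).natDegree ≤ k := by
  have h := MvPolynomial.aeval_natDegree_le (m := k) (n := 1) (P : MvPolynomial (Fin (n + 1)) ℝ)
    ((MvPolynomial.mem_restrictTotalDegree _ _ _).mp P.2)
    (j.insertNth X (fun i => C (y i)) : Fin (n + 1) → ℝ[X]) (fun i => by
      refine j.succAboveCases ?_ (fun i => ?_) i <;> simp)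
  simpa [linePoly] using h

/-- The trace bound is applied to the derivative along the line, whence the constant `Gam k` for
cellwise degree `k`. The strict bound on `degree` also covers `k = 0`, where the derivative is zero.
-/
theorem degree_derivative_linePoly_lt (j : Fin (n + 1)) (y : Fin n → ℝ) {k : ℕ}
    (P : MvPolynomial.restrictTotalDegree (Fin (n + 1)) ℝ k) :
    (derivative (linePoly j y (P : MvPolynomial (Fin (n + 1)) ℝ))).degree < k := by
  have h := natDegree_linePoly_le j y P
  rcases eq_or_ne (linePoly j y (P : MvPolynomial (Fin (n + 1)) ℝ)) 0 with h0 | h0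
  · rw [h0, derivative_zero, degree_zero]
    exact WithBot.bot_lt_coe k
  · exact (degree_derivative_lt h0).trans_le (natDegree_le_iff_degree_le.mp h)

theorem continuous_insertNth (j : Fin (n + 1)) :
    Continuous fun q : ℝ × (Fin n → ℝ) => (j.insertNth q.1 q.2 : Fin (n + 1) → ℝ) :=
  Continuous.finInsertNth (A := fun _ => ℝ) j continuous_fst continuous_snd

theorem insertNth_mem_Icc {B : Box (Fin (n + 1))} {j : Fin (n + 1)} {t : ℝ} {y : Fin n → ℝ} :
    (j.insertNth t y : Fin (n + 1) → ℝ) ∈ Box.Icc B ↔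
      t ∈ Set.Icc (B.lower j) (B.upper j) ∧ y ∈ Box.Icc (B.face j) := by
  rw [Box.Icc_def, Box.Icc_def, Fin.insertNth_mem_Icc]
  rfl

theorem mem_Ioo_iff {ι : Type*} {B : Box ι} {x : ι → ℝ} :
    x ∈ Box.Ioo B ↔ ∀ i, x i ∈ Set.Ioo (B.lower i) (B.upper i) := by
  rw [Box.Ioo]
  exact Set.mem_univ_pi

theorem insertNth_mem_Ioo {B : Box (Fin (n + 1))} {j : Fin (n + 1)} {t : ℝ} {y : Fin n → ℝ} :
    (j.insertNth t y : Fin (n + 1) → ℝ) ∈ Box.Ioo B ↔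
      t ∈ Set.Ioo (B.lower j) (B.upper j) ∧ y ∈ Box.Ioo (B.face j) := by
  rw [mem_Ioo_iff, mem_Ioo_iff, Fin.forall_iff_succAbove j]
  simp [Box.face]

theorem isOpen_boxIoo {ι : Type*} [Finite ι] (B : Box ι) : IsOpen (Box.Ioo B) :=
  isOpen_set_pi Set.finite_univ fun _ _ => isOpen_Ioo

theorem measurableSet_boxIcc {ι : Type*} [Countable ι] (B : Box ι) : MeasurableSet (Box.Icc B) :=
  measurableSet_Icc

/-- Fubini's theorem for slices in direction `j`. -/
theorem setIntegral_insertNth (j : Fin (n + 1)) {A : Set (Fin (n + 1) → ℝ)} {s : Set ℝ}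
    {u : Set (Fin n → ℝ)}
    (hA : ∀ t y, (j.insertNth t y : Fin (n + 1) → ℝ) ∈ A ↔ t ∈ s ∧ y ∈ u)
    {f : (Fin (n + 1) → ℝ) → ℝ} (hf : IntegrableOn f A) :
    IntegrableOn (fun y => ∫ t in s, f (j.insertNth t y)) u ∧
      ∫ x in A, f x = ∫ y in u, ∫ t in s, f (j.insertNth t y) := by
  have hmp : MeasurePreserving (MeasurableEquiv.piFinSuccAbove (fun _ : Fin (n + 1) => ℝ) j).symm :=
    (volume_preserving_piFinSuccAbove (fun _ : Fin (n + 1) => ℝ) j).symm _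
  have hpre : (MeasurableEquiv.piFinSuccAbove (fun _ : Fin (n + 1) => ℝ) j).symm ⁻¹' A
      = s ×ˢ u := by
    ext ⟨t, y⟩
    exact hA t y
  have hemb := (MeasurableEquiv.piFinSuccAbove (fun _ : Fin (n + 1) => ℝ) j).symm.measurableEmbedding
  have hint : Integrable (fun q : ℝ × (Fin n → ℝ) => f (j.insertNth q.1 q.2))
      ((volume.restrict s).prod (volume.restrict u)) := by
    rw [Measure.prod_restrict, ← hpre]
    exact (hmp.integrableOn_comp_preimage hemb).mpr hf
  refine ⟨hint.integral_prod_right, ?_⟩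
  rw [← integral_prod_symm _ hint, Measure.prod_restrict, ← hpre]
  exact (hmp.setIntegral_preimage_emb hemb f A).symm

theorem setIntegral_Icc_insertNth (B : Box (Fin (n + 1))) (j : Fin (n + 1))
    {f : (Fin (n + 1) → ℝ) → ℝ} (hf : Continuous f) :
    IntegrableOn (fun y => ∫ t in B.lower j..B.upper j, f (j.insertNth t y)) (Box.Icc (B.face j)) ∧
      ∫ x in Box.Icc B, f x
        = ∫ y in Box.Icc (B.face j), ∫ t in B.lower j..B.upper j, f (j.insertNth t y) := by
  have h := setIntegral_insertNth j (fun t y => insertNth_mem_Icc (B := B)) (f := f)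
    (hf.continuousOn.integrableOn_compact B.isCompact_Icc)
  simp only [intervalIntegral.integral_of_le (B.lower_lt_upper j).le, ← integral_Icc_eq_integral_Ioc]
  exact h

end Lines

namespace RectMesh

variable {n : ℕ} {Ω : Set (Fin (n + 1) → ℝ)} {T : RectMesh Ω} {k : ℕ}

/-- The polynomial that represents `v` on the cell `K`, restricted to a line in direction `j`. -/
def line (v : T.Space k) (K : Fin T.numCells) (j : Fin (n + 1)) (y : Fin n → ℝ) : ℝ[X] :=
  linePoly j y (v K : MvPolynomial (Fin (n + 1)) ℝ)

theorem val_insertNth (v : T.Space k) (K : Fin T.numCells) (j : Fin (n + 1)) (t : ℝ)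
    (y : Fin n → ℝ) : val v K (j.insertNth t y) = (line v K j y).eval t :=
  (eval_linePoly j y t _).symm

theorem d1_insertNth (v : T.Space k) (K : Fin T.numCells) (j : Fin (n + 1)) (t : ℝ)
    (y : Fin n → ℝ) : d1 v K j (j.insertNth t y) = (derivative (line v K j y)).eval t := by
  rw [line, derivative_linePoly, eval_linePoly, d1]

theorem d2_insertNth (v : T.Space k) (K : Fin T.numCells) (j : Fin (n + 1)) (t : ℝ)
    (y : Fin n → ℝ) :
    d2 v K j (j.insertNth t y) = (derivative (derivative (line v K j y))).eval t := by
  rw [line, derivative_linePoly, derivative_linePoly, eval_linePoly, d2]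

@[fun_prop]
theorem continuous_val (v : T.Space k) (K : Fin T.numCells) : Continuous (val v K) :=
  MvPolynomial.continuous_eval _

@[fun_prop]
theorem continuous_d1 (v : T.Space k) (K : Fin T.numCells) (j : Fin (n + 1)) :
    Continuous (d1 v K j) :=
  MvPolynomial.continuous_eval _

@[fun_prop]
theorem continuous_d2 (v : T.Space k) (K : Fin T.numCells) (j : Fin (n + 1)) :
    Continuous (d2 v K j) :=
  MvPolynomial.continuous_eval _

@[fun_prop]
theorem continuous_facePoint (B : Box (Fin (n + 1))) (j : Fin (n + 1)) (s : Bool) :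
    Continuous (facePoint B j s) :=
  (continuous_insertNth j).comp (continuous_const.prodMk continuous_id)

theorem measurableSet_faceIn (T : RectMesh Ω) {Γ : Set (Fin (n + 1) → ℝ)} (hΓ : MeasurableSet Γ)
    (K : Fin T.numCells) (j : Fin (n + 1)) (s : Bool) : MeasurableSet (T.faceIn Γ K j s) :=
  (measurableSet_boxIcc _).inter ((continuous_facePoint _ j s).measurable hΓ)

/-! ### Decomposition of the forms into contributions of lines -/

/-- The common shape of the bilinear form and of the energy: cell, interface and boundary terms. -/
def meshSum (T : RectMesh Ω) (Γ : Set (Fin (n + 1) → ℝ))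
    (f : Fin T.numCells → Fin (n + 1) → (Fin (n + 1) → ℝ) → ℝ)
    (g : Fin T.numCells → Fin T.numCells → Fin (n + 1) → (Fin (n + 1) → ℝ) → ℝ)
    (h : Fin T.numCells → Fin (n + 1) → Bool → (Fin (n + 1) → ℝ) → ℝ) : ℝ :=
  (∑ K, ∫ x in Box.Icc (T.cell K), ∑ j, f K j x) + T.interfaceIntegral g + T.boundaryIntegral Γ h

/-- `K₁` and `K₂` are adjacent in direction `j`, and the line through `y` meets both. -/
def LineAdjacent (T : RectMesh Ω) (j : Fin (n + 1)) (y : Fin n → ℝ) (K₁ K₂ : Fin T.numCells) :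
    Prop :=
  Adjacent (T.cell K₁) (T.cell K₂) j ∧
    y ∈ Box.Icc ((T.cell K₁).face j) ∩ Box.Icc ((T.cell K₂).face j)

open Classical in
/-- The contribution to `meshSum` of the line in direction `j` through `y`. -/
def lineSum (T : RectMesh Ω) (Γ : Set (Fin (n + 1) → ℝ))
    (f : Fin T.numCells → Fin (n + 1) → (Fin (n + 1) → ℝ) → ℝ)
    (g : Fin T.numCells → Fin T.numCells → Fin (n + 1) → (Fin (n + 1) → ℝ) → ℝ)
    (h : Fin T.numCells → Fin (n + 1) → Bool → (Fin (n + 1) → ℝ) → ℝ)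
    (j : Fin (n + 1)) (y : Fin n → ℝ) : ℝ :=
  (∑ K, if y ∈ Box.Icc ((T.cell K).face j) then
      ∫ t in (T.cell K).lower j..(T.cell K).upper j, f K j (j.insertNth t y) else 0)
  + (∑ K₁, ∑ K₂, if T.LineAdjacent j y K₁ K₂ then
      g K₁ K₂ j (facePoint (T.cell K₁) j true y) else 0)
  + ∑ K, ∑ s, if y ∈ T.faceIn Γ K j s then h K j s (facePoint (T.cell K) j s y) else 0

theorem integrable_ite_mem {u : Set (Fin n → ℝ)} (hu : MeasurableSet u) {F : (Fin n → ℝ) → ℝ}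
    (hF : IntegrableOn F u) [DecidablePred (· ∈ u)] :
    Integrable (fun y => if y ∈ u then F y else 0) ∧
      ∫ y, (if y ∈ u then F y else 0) = ∫ y in u, F y := by
  classical
  have h : (fun y => if y ∈ u then F y else 0) = u.indicator F := by
    funext y
    by_cases hy : y ∈ u <;> simp [hy]
  rw [h]
  exact ⟨(integrable_indicator_iff hu).mpr hF, integral_indicator hu⟩

/-- Fubini's theorem slices the cell integrals along direction `j`; the interface and boundary terms
are already integrals over the parameter of a line. -/
theorem meshSum_eq_sum_integral_lineSum (T : RectMesh Ω) {Γ : Set (Fin (n + 1) → ℝ)}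
    (hΓ : MeasurableSet Γ)
    {f : Fin T.numCells → Fin (n + 1) → (Fin (n + 1) → ℝ) → ℝ}
    {g : Fin T.numCells → Fin T.numCells → Fin (n + 1) → (Fin (n + 1) → ℝ) → ℝ}
    {h : Fin T.numCells → Fin (n + 1) → Bool → (Fin (n + 1) → ℝ) → ℝ}
    (hf : ∀ K j, Continuous (f K j)) (hg : ∀ K₁ K₂ j, Continuous (g K₁ K₂ j))
    (hh : ∀ K j s, Continuous (h K j s)) :
    (∀ j, Integrable (T.lineSum Γ f g h j)) ∧
      T.meshSum Γ f g h = ∑ j, ∫ y, T.lineSum Γ f g h j y := by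
  classical
  have hF := fun j K => integrable_ite_mem (measurableSet_boxIcc ((T.cell K).face j))
    (setIntegral_Icc_insertNth (T.cell K) j (hf K j)).1
  have hG : ∀ j K₁ K₂, Integrable (fun y => if T.LineAdjacent j y K₁ K₂ then
      g K₁ K₂ j (facePoint (T.cell K₁) j true y) else 0) ∧
      ∫ y, (if T.LineAdjacent j y K₁ K₂ then g K₁ K₂ j (facePoint (T.cell K₁) j true y) else 0)
        = if Adjacent (T.cell K₁) (T.cell K₂) j then
            ∫ y in Box.Icc ((T.cell K₁).face j) ∩ Box.Icc ((T.cell K₂).face j),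
              g K₁ K₂ j (facePoint (T.cell K₁) j true y) else 0 := by
    intro j K₁ K₂
    by_cases hadj : Adjacent (T.cell K₁) (T.cell K₂) j
    · simp only [LineAdjacent, hadj, true_and, if_true]
      refine integrable_ite_mem ((measurableSet_boxIcc _).inter (measurableSet_boxIcc _)) ?_
      exact (((hg K₁ K₂ j).comp (continuous_facePoint _ _ _)).continuousOn.integrableOn_compact
        (Box.isCompact_Icc _)).mono_set Set.inter_subset_left
    · simp [LineAdjacent, hadj]
  have hH := fun j K s => integrable_ite_mem (T.measurableSet_faceIn hΓ K j s)
    (F := fun y => h K j s (facePoint (T.cell K) j s y)) ((((hh K j s).comp (continuous_facePoint (T.cell K) j s)).continuousOn.integrableOn_compact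
        (Box.isCompact_Icc _)).mono_set Set.inter_subset_left)
  have h1 := fun j => integrable_finsetSum Finset.univ fun K _ => (hF j K).1
  have h2 := fun j => integrable_finsetSum Finset.univ fun K₁ _ =>
    integrable_finsetSum Finset.univ fun K₂ _ => (hG j K₁ K₂).1
  have h3 := fun j => integrable_finsetSum Finset.univ fun K _ =>
    integrable_finsetSum Finset.univ fun s _ => (hH j K s).1
  refine ⟨fun j => ((h1 j).add (h2 j)).add (h3 j), ?_⟩
  have hj : ∀ j, ∫ y, T.lineSum Γ f g h j y
      = (∑ K, ∫ x in Box.Icc (T.cell K), f K j x)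
        + (∑ K₁, ∑ K₂, if Adjacent (T.cell K₁) (T.cell K₂) j then
            ∫ y in Box.Icc ((T.cell K₁).face j) ∩ Box.Icc ((T.cell K₂).face j),
              g K₁ K₂ j (facePoint (T.cell K₁) j true y) else 0)
        + ∑ K, ∑ s, ∫ y in T.faceIn Γ K j s, h K j s (facePoint (T.cell K) j s y) := by
    intro j
    have h12 := fun j => (h1 j).add (h2 j)
    simp only [Pi.add_def] at h12
    simp only [lineSum]
    rw [integral_add (h12 j) (h3 j), integral_add (h1 j) (h2 j),
      integral_finsetSum _ fun K _ => (hF j K).1,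
      integral_finsetSum _ fun K₁ _ => integrable_finsetSum _ fun K₂ _ => (hG j K₁ K₂).1,
      integral_finsetSum _ fun K _ => integrable_finsetSum _ fun s _ => (hH j K s).1]
    congr 1
    · congr 1
      · refine Finset.sum_congr rfl fun K _ => ?_
        rw [(hF j K).2, (setIntegral_Icc_insertNth (T.cell K) j (hf K j)).2]
      · refine Finset.sum_congr rfl fun K₁ _ => ?_
        rw [integral_finsetSum _ fun K₂ _ => (hG j K₁ K₂).1]
        exact Finset.sum_congr rfl fun K₂ _ => (hG j K₁ K₂).2
    · refine Finset.sum_congr rfl fun K _ => ?_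
      rw [integral_finsetSum _ fun s _ => (hH j K s).1]
      exact Finset.sum_congr rfl fun s _ => (hH j K s).2
  simp only [hj, Finset.sum_add_distrib, meshSum, interfaceIntegral, boundaryIntegral]
  congr 1
  · congr 1
    rw [Finset.sum_comm]
    refine Finset.sum_congr rfl fun K _ => ?_
    exact integral_finsetSum _ fun j _ =>
      (hf K j).continuousOn.integrableOn_compact (Box.isCompact_Icc _)
  · rw [Finset.sum_comm]

/-- `y` lies on no hyperplane spanned by a lateral face of a cell. -/
def Generic (T : RectMesh Ω) (j : Fin (n + 1)) (y : Fin n → ℝ) : Prop :=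
  ∀ K, y ∈ Box.Icc ((T.cell K).face j) → y ∈ Box.Ioo ((T.cell K).face j)

theorem ae_generic (T : RectMesh Ω) (j : Fin (n + 1)) : ∀ᵐ y, T.Generic j y := by
  simp only [Generic, ae_all_iff]
  intro K
  filter_upwards [(Box.Ioo_ae_eq_Icc ((T.cell K).face j)).mem_iff] with y hy using hy.mpr

end RectMesh
end DDG

end

noncomputable section
namespace DDG

open Polynomial BoxIntegral

/-! ### One-dimensional estimates -/

section OneDim

theorem sum_ite_add_ite_le_one {ι : Type*} [Fintype ι] {P : ι → Prop} {Q : Prop} [DecidablePred P]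
    [Decidable Q] (hP : ∀ K K', P K → P K' → K = K') (hQ : ∀ K, P K → ¬Q) :
    (∑ K, if P K then (1 : ℝ) else 0) + (if Q then 1 else 0) ≤ 1 := by
  by_cases h : ∃ K, P K
  · obtain ⟨K, hK⟩ := h
    rw [Finset.sum_eq_single K (fun K' _ hne => if_neg fun h => hne (hP K' K h hK)) (by simp),
      if_pos hK, if_neg (hQ K hK), add_zero]
  · push Not at h
    simp only [h, if_false, Finset.sum_const_zero, zero_add]
    split_ifs <;> norm_num

/-- Double counting: a cell contributes once for each interface or boundary face at its two ends,
and each end carries at most one of them. -/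
theorem sum_adjacent_add_sum_ends_le {ι : Type*} [Fintype ι] {adj : ι → ι → Prop}
    {ends : ι → Bool → Prop} [∀ K K', Decidable (adj K K')] [∀ K s, Decidable (ends K s)]
    {X : ι → ℝ} (hX : ∀ K, 0 ≤ X K)
    (hr : ∀ K, (∑ K', if adj K K' then (1 : ℝ) else 0) + (if ends K true then 1 else 0) ≤ 1)
    (hl : ∀ K, (∑ K', if adj K' K then (1 : ℝ) else 0) + (if ends K false then 1 else 0) ≤ 1) :
    (∑ K, ∑ K', if adj K K' then X K + X K' else 0) + (∑ K, ∑ s, if ends K s then X K else 0)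
      ≤ 2 * ∑ K, X K := by
  have e : (∑ K, ∑ K', if adj K K' then X K + X K' else 0)
      + (∑ K, ∑ s, if ends K s then X K else 0)
      = (∑ K, X K * ((∑ K', if adj K K' then (1 : ℝ) else 0) + (if ends K true then 1 else 0)))
      + ∑ K, X K * ((∑ K', if adj K' K then (1 : ℝ) else 0) + (if ends K false then 1 else 0)) := by
    have h1 : (∑ K, ∑ K', if adj K K' then X K + X K' else 0)
        = (∑ K, X K * ∑ K', if adj K K' then (1 : ℝ) else 0)
          + ∑ K, X K * ∑ K', if adj K' K then (1 : ℝ) else 0 := by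
      simp only [Finset.mul_sum, mul_ite, mul_one, mul_zero]
      rw [Finset.sum_comm (f := fun K K' => if adj K' K then X K else 0), ← Finset.sum_add_distrib]
      refine Finset.sum_congr rfl fun K _ => ?_
      rw [← Finset.sum_add_distrib]
      refine Finset.sum_congr rfl fun K' _ => ?_
      split_ifs <;> simp
    simp only [h1, mul_add, Finset.sum_add_distrib, Fintype.sum_bool, mul_ite, mul_one, mul_zero]
    ring
  rw [e, two_mul]
  refine add_le_add ?_ ?_ <;> refine Finset.sum_le_sum fun K _ => ?_
  · exact mul_le_of_le_one_right (hX K) (hr K)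
  · exact mul_le_of_le_one_right (hX K) (hl K)

/-- Complete the square with weight `β'`, then use `(P₁ + P₂)² ≤ 2 P₁² + 2 P₂²` and the trace
bounds. Each adjacent cell pays `βs / (2 β')` of its gradient integral. -/
theorem interface_bound {β₀ β' βs h J P₁ P₂ I₁ I₂ : ℝ} (hβ' : 0 < β') (hh : 0 < h)
    (h₁ : h * P₁ ^ 2 ≤ βs * I₁) (h₂ : h * P₂ ^ 2 ≤ βs * I₂) :
    (β₀ - β') * (J ^ 2 / h) - βs / β' / 2 * (I₁ + I₂) ≤ β₀ * (J ^ 2 / h) + J * (P₁ + P₂) := by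
  have hsq : 0 ≤ β' * (J ^ 2 / h) + J * (P₁ + P₂) + h * (P₁ + P₂) ^ 2 / (4 * β') := by
    have : β' * (J ^ 2 / h) + J * (P₁ + P₂) + h * (P₁ + P₂) ^ 2 / (4 * β')
        = β' / h * (J + h * (P₁ + P₂) / (2 * β')) ^ 2 := by
      field_simp
      ring
    rw [this]
    positivity
  have hb : h * (P₁ + P₂) ^ 2 / (4 * β') ≤ βs / β' / 2 * (I₁ + I₂) := by
    have e : βs / β' / 2 * (I₁ + I₂) = 2 * (βs * (I₁ + I₂)) / (4 * β') := by
      field_simp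
      ring
    rw [e]
    refine div_le_div_of_nonneg_right ?_ (by positivity)
    nlinarith [mul_nonneg hh.le (sq_nonneg (P₁ - P₂))]
  linarith

/-- A Dirichlet face has only one adjacent cell, so the whole cross term `2 V N` falls on it. The
stronger trace bound with factor `2` keeps the price at `βs / (2 β')`, as at an interface; this is
the origin of `2 * Gam k 0` in the threshold. -/
theorem boundary_bound {β₀ β' βs w V N I : ℝ} (hβ' : 0 < β') (hw : 0 < w)
    (hN : 2 * (w * N ^ 2) ≤ βs * I) :
    (β₀ - β') * (V ^ 2 / w) - βs / β' / 2 * I ≤ β₀ * (V ^ 2 / w) - 2 * (V * N) := by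
  have hsq : 0 ≤ β' * (V ^ 2 / w) - 2 * (V * N) + w * N ^ 2 / β' := by
    have : β' * (V ^ 2 / w) - 2 * (V * N) + w * N ^ 2 / β' = β' / w * (V - w * N / β') ^ 2 := by
      field_simp
      ring
    rw [this]
    positivity
  have hb : w * N ^ 2 / β' ≤ βs / β' / 2 * I := by
    have e : βs / β' / 2 * I = (βs * I / 2) / β' := by ring
    rw [e]
    gcongr
    linarith
  linarith

theorem sq_sub_le_width_mul (p : ℝ[X]) {a b s t : ℝ} (hs : s ∈ Set.Icc a b) (ht : t ∈ Set.Icc a b) :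
    (p.eval s - p.eval t) ^ 2 ≤ (b - a) * ∫ x in a..b, (derivative p).eval x ^ 2 := by
  wlog hst : s ≤ t generalizing s t
  · rw [← neg_sub, neg_sq]
    exact this ht hs (le_of_not_ge hst)
  set q : ℝ[X] := derivative p
  have hq : ∀ c d, IntervalIntegrable (fun x => q.eval x ^ 2) volume c d := fun c d =>
    (q.continuous.pow 2).intervalIntegrable c d
  have hmono : ∫ x in s..t, q.eval x ^ 2 ≤ ∫ x in a..b, q.eval x ^ 2 :=
    intervalIntegral.integral_mono_interval hs.1 hst ht.2
      (Filter.Eventually.of_forall fun x => sq_nonneg _) (hq a b)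
  have hδ : ∫ x in s..t, q.eval x = p.eval t - p.eval s := integral_derivative_eval p s t
  set δ := p.eval t - p.eval s with hδdef
  -- The Cauchy–Schwarz inequality, in the form that the variance of the derivative on `[s, t]` is
  -- nonnegative.
  have hvar : 0 ≤ ∫ x in s..t, ((t - s) * q.eval x - δ) ^ 2 :=
    intervalIntegral.integral_nonneg hst fun x _ => sq_nonneg _
  have hexp : ∫ x in s..t, ((t - s) * q.eval x - δ) ^ 2
      = (t - s) ^ 2 * (∫ x in s..t, q.eval x ^ 2) - (t - s) * δ ^ 2 := by
    have e : ∀ x, ((t - s) * q.eval x - δ) ^ 2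
        = (t - s) ^ 2 * q.eval x ^ 2 - 2 * (t - s) * δ * q.eval x + δ ^ 2 := fun x => by ring
    simp only [e]
    rw [intervalIntegral.integral_add (((hq s t).const_mul _).sub
      ((intervalIntegrable_eval q s t).const_mul _)) intervalIntegrable_const,
      intervalIntegral.integral_sub ((hq s t).const_mul _)
      ((intervalIntegrable_eval q s t).const_mul _)]
    simp only [intervalIntegral.integral_const_mul, intervalIntegral.integral_const, smul_eq_mul, hδ]
    ring
  have hI : 0 ≤ ∫ x in s..t, q.eval x ^ 2 :=
    intervalIntegral.integral_nonneg hst fun x _ => sq_nonneg _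
  have key : δ ^ 2 ≤ (t - s) * ∫ x in s..t, q.eval x ^ 2 := by
    rcases hst.eq_or_lt with rfl | hlt
    · simp [hδdef]
    · refine le_of_mul_le_mul_left ?_ (sub_pos.mpr hlt)
      nlinarith
  calc (p.eval s - p.eval t) ^ 2 = δ ^ 2 := by rw [hδdef]; ring
    _ ≤ (t - s) * ∫ x in s..t, q.eval x ^ 2 := key
    _ ≤ (b - a) * ∫ x in a..b, q.eval x ^ 2 := by
      have h1 : t - s ≤ b - a := by linarith [hs.1, ht.2]
      have h2 : 0 ≤ b - a := by linarith
      gcongr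

/-! ### Chains of intervals on a line. -/

theorem sum_length_le {ι : Type*} {S : Finset ι} {a b : ι → ℝ} {R : ℝ} (hR : 0 ≤ R)
    (hab : ∀ K ∈ S, a K ≤ b K)
    (hdisj : ∀ K ∈ S, ∀ K' ∈ S, K ≠ K' → b K ≤ a K' ∨ b K' ≤ a K)
    (ha : ∀ K ∈ S, -R ≤ a K) (hb : ∀ K ∈ S, b K ≤ R) : ∑ K ∈ S, (b K - a K) ≤ 2 * R := by
  have hU : volume (⋃ K ∈ S, Set.Ioo (a K) (b K)) = ∑ K ∈ S, volume (Set.Ioo (a K) (b K)) := by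
    refine measure_biUnion_finset ?_ fun K _ => measurableSet_Ioo
    intro K hK K' hK' hne
    refine Set.disjoint_left.mpr fun x hx hx' => ?_
    rcases hdisj K hK K' hK' hne with h | h
    · exact absurd (hx.2.trans_le h) (not_lt.mpr hx'.1.le)
    · exact absurd (hx'.2.trans_le h) (not_lt.mpr hx.1.le)
  have hle : volume (⋃ K ∈ S, Set.Ioo (a K) (b K)) ≤ volume (Set.Icc (-R) R) := by
    refine measure_mono (Set.iUnion₂_subset fun K hK x hx => ?_)
    exact ⟨(ha K hK).trans hx.1.le, hx.2.le.trans (hb K hK)⟩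
  simp only [hU, Real.volume_Ioo, Real.volume_Icc] at hle
  rw [← ENNReal.ofReal_sum_of_nonneg fun K hK => sub_nonneg.mpr (hab K hK),
    ENNReal.ofReal_le_ofReal_iff (by linarith)] at hle
  linarith

/-- If finitely many intervals cover `(c, d)` and none of them contains `c` in its interior, then
one of them starts at `c`. -/
theorem exists_left_endpoint_eq {ι : Type*} {S : Finset ι} {a b : ι → ℝ} {c d : ℝ} (hcd : c < d)
    (hleft : ∀ K ∈ S, a K < c → b K ≤ c)
    (hcov : ∀ x ∈ Set.Ioo c d, ∃ K ∈ S, x ∈ Set.Icc (a K) (b K)) : ∃ K ∈ S, a K = c := by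
  by_contra! hne
  -- By finiteness, some point right of `c` precedes every left endpoint beyond `c`. An interval
  -- that contains it starts at or before `c`, and by `hleft` not before.
  obtain ⟨x, hx, hxa⟩ : ∃ x ∈ Set.Ioo c d, ∀ K ∈ S, c < a K → x < a K := by
    by_cases hS : (S.filter (c < a ·)).Nonempty
    · obtain ⟨K₀, hK₀, hmin⟩ := Finset.exists_min_image _ a hS
      have h0 : c < a K₀ := (Finset.mem_filter.mp hK₀).2
      obtain ⟨x, hx1, hx2⟩ := exists_between (lt_min hcd h0)
      refine ⟨x, ⟨hx1, hx2.trans_le (min_le_left _ _)⟩, fun K hK hcK => ?_⟩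
      exact (hx2.trans_le (min_le_right _ _)).trans_le (hmin K (Finset.mem_filter.mpr ⟨hK, hcK⟩))
    · obtain ⟨x, hx⟩ := exists_between hcd
      refine ⟨x, hx, fun K hK hcK => (hS ⟨K, Finset.mem_filter.mpr ⟨hK, hcK⟩⟩).elim⟩
  obtain ⟨K, hK, hxK⟩ := hcov x hx
  rcases lt_trichotomy (a K) c with h | h | h
  · exact absurd (hxK.2.trans (hleft K hK h)) (not_le.mpr hx.1)
  · exact hne K hK h
  · exact absurd (hxa K hK h) (not_lt.mpr hxK.1)

theorem exists_right_endpoint_eq {ι : Type*} {S : Finset ι} {a b : ι → ℝ} {c d : ℝ} (hcd : c < d)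
    (hright : ∀ K ∈ S, d < b K → d ≤ a K)
    (hcov : ∀ x ∈ Set.Ioo c d, ∃ K ∈ S, x ∈ Set.Icc (a K) (b K)) : ∃ K ∈ S, b K = d := by
  -- Reflection at the origin.
  obtain ⟨K, hK, h⟩ := exists_left_endpoint_eq (S := S) (a := fun K => -b K) (b := fun K => -a K)
    (neg_lt_neg hcd) (fun K hK h => neg_le_neg (hright K hK (neg_lt_neg_iff.mp h)))
    (fun x hx => by
      obtain ⟨K, hK, h⟩ := hcov (-x) ⟨by linarith [hx.2], by linarith [hx.1]⟩
      exact ⟨K, hK, by linarith [h.2], by linarith [h.1]⟩)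
  exact ⟨K, hK, neg_injective h⟩

/-- The variation between two points of a chain of intervals is bounded by the variation on the
intervals and the jumps between consecutive ones. -/
theorem abs_sub_le_sum_variation {ι : Type*} [DecidableEq ι] {a b : ι → ℝ} {p : ι → ℝ → ℝ}
    {D : ι → ℝ} {J : ι → ι → ℝ} {K' : ι} {t : ℝ} (ht : t ∈ Set.Ioc (a K') (b K'))
    (hJ : ∀ K₁ K₂, |p K₁ (b K₁) - p K₂ (b K₁)| ≤ J K₁ K₂) (S : Finset ι) {K : ι} {s : ℝ}
    (hab : ∀ K ∈ S, a K < b K)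
    (hdisj : ∀ K ∈ S, ∀ K' ∈ S, K ≠ K' → b K ≤ a K' ∨ b K' ≤ a K)
    (hD : ∀ K ∈ S, ∀ s ∈ Set.Icc (a K) (b K), ∀ t ∈ Set.Icc (a K) (b K), |p K s - p K t| ≤ D K)
    (hcov : ∀ x ∈ Set.Ioo s t, ∃ K ∈ S, x ∈ Set.Icc (a K) (b K)) (hst : s < t)
    (hK : K ∈ S) (hK' : K' ∈ S) (hs : s ∈ Set.Icc (a K) (b K)) :
    |p K s - p K' t| ≤ ∑ K ∈ S, D K + ∑ K₁ ∈ S, ∑ K₂ ∈ S, if b K₁ = a K₂ then J K₁ K₂ else 0 := by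
  induction hm : S.card generalizing S K s with
  | zero => simp [Finset.card_eq_zero.mp hm] at hK
  | succ m ih =>
    have hD0 : ∀ K ∈ S, 0 ≤ D K := fun K hK =>
      (abs_nonneg _).trans (hD K hK _ ⟨le_rfl, (hab K hK).le⟩ _ ⟨le_rfl, (hab K hK).le⟩)
    have hJ0 : ∀ K₁ K₂, 0 ≤ if b K₁ = a K₂ then J K₁ K₂ else 0 := fun K₁ K₂ => by
      split_ifs
      · exact (abs_nonneg _).trans (hJ K₁ K₂)
      · exact le_rfl
    by_cases hKK : K = K'
    · subst hKK
      calc |p K s - p K t| ≤ D K := hD K hK s hs t ⟨ht.1.le, ht.2⟩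
        _ ≤ ∑ K ∈ S, D K := Finset.single_le_sum (f := D) hD0 hK
        _ ≤ _ := le_add_of_nonneg_right
          (Finset.sum_nonneg fun K₁ _ => Finset.sum_nonneg fun K₂ _ => hJ0 K₁ K₂)
    have hb : b K ≤ a K' := by
      rcases hdisj K hK K' hK' hKK with h | h
      · exact h
      · linarith [ht.2, hs.1]
    -- That `t` lies in a half-open interval makes this strict, so a nonempty gap `(b K, t)` remains
    -- for the induction.
    have hbt : b K < t := hb.trans_lt ht.1
    -- Beyond its right end `K` is no longer needed. Removing it makes the induction on the number
    -- of intervals work and ensures that each interval and each jump is counted once.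
    have hcov' : ∀ x ∈ Set.Ioo (b K) t, ∃ K₁ ∈ S.erase K, x ∈ Set.Icc (a K₁) (b K₁) := by
      intro x hx
      obtain ⟨K₁, hK₁, hx₁⟩ := hcov x ⟨hs.2.trans_lt hx.1, hx.2⟩
      refine ⟨K₁, Finset.mem_erase.mpr ⟨?_, hK₁⟩, hx₁⟩
      rintro rfl
      exact absurd hx.1 (not_lt.mpr hx₁.2)
    obtain ⟨K₁, hK₁, hKa⟩ := exists_left_endpoint_eq hbt (fun K₁ hK₁ h => by
      rw [Finset.mem_erase] at hK₁
      rcases hdisj K₁ hK₁.2 K hK hK₁.1 with h' | h'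
      · exact h'.trans (hab K hK).le
      · exact absurd h (not_lt.mpr h')) hcov'
    have hrec := ih (S.erase K) (fun K h => hab K (Finset.mem_of_mem_erase h))
      (fun K h K' h' => hdisj K (Finset.mem_of_mem_erase h) K' (Finset.mem_of_mem_erase h'))
      (fun K h => hD K (Finset.mem_of_mem_erase h)) hcov' hbt hK₁
      (Finset.mem_erase.mpr ⟨fun h => hKK h.symm, hK'⟩)
      ⟨hKa.le, hKa ▸ (hab K₁ (Finset.mem_of_mem_erase hK₁)).le⟩
      (by rw [Finset.card_erase_of_mem hK, hm]; rfl)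
    have hsum1 : ∑ K ∈ S, D K = D K + ∑ K ∈ S.erase K, D K := (Finset.add_sum_erase S D hK).symm
    have hsum2 : J K K₁ + (∑ K₁ ∈ S.erase K, ∑ K₂ ∈ S.erase K, if b K₁ = a K₂ then J K₁ K₂ else 0)
        ≤ ∑ K₁ ∈ S, ∑ K₂ ∈ S, if b K₁ = a K₂ then J K₁ K₂ else 0 := by
      rw [← Finset.add_sum_erase S (fun K₁ => ∑ K₂ ∈ S, if b K₁ = a K₂ then J K₁ K₂ else 0) hK]
      refine add_le_add ?_ (Finset.sum_le_sum fun K₁ _ =>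
        Finset.sum_le_sum_of_subset_of_nonneg (Finset.erase_subset _ _) fun K₂ _ _ => hJ0 K₁ K₂)
      calc J K K₁ = if b K = a K₁ then J K K₁ else 0 := by rw [if_pos hKa.symm]
        _ ≤ _ := Finset.single_le_sum (f := fun K₂ => if b K = a K₂ then J K K₂ else 0)
          (fun K₂ _ => hJ0 K K₂) (Finset.mem_of_mem_erase hK₁)
    have h1 := hD K hK s hs (b K) ⟨(hab K hK).le, le_rfl⟩
    have h2 := hJ K K₁
    have h3 : |p K s - p K' t| ≤ |p K s - p K (b K)| + |p K (b K) - p K₁ (b K)|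
        + |p K₁ (b K) - p K' t| :=
      (abs_sub_le _ (p K₁ (b K)) _).trans (add_le_add_left (abs_sub_le _ _ _) _)
    linarith

end OneDim
end DDG

end

noncomputable section
namespace DDG

open Polynomial BoxIntegral

namespace RectMesh

variable {n : ℕ} {Ω : Set (Fin (n + 1) → ℝ)} {T : RectMesh Ω} {k : ℕ}

/-! ### Geometry of the cells met by a line -/

theorem width_pos (B : Box (Fin (n + 1))) (j : Fin (n + 1)) : 0 < width B j :=
  sub_pos.mpr (B.lower_lt_upper j)

theorem hInterface_pos (T : RectMesh Ω) (K₁ K₂ : Fin T.numCells) (j : Fin (n + 1)) :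
    0 < T.hInterface K₁ K₂ j :=
  half_pos (add_pos (width_pos _ _) (width_pos _ _))

theorem Ioo_cell_subset (T : RectMesh Ω) (K : Fin T.numCells) : Box.Ioo (T.cell K) ⊆ Ω := by
  refine Set.Subset.trans ?_ T.interior_union.symm.subset
  exact interior_maximal ((Box.Ioo_subset_Icc _).trans (Set.subset_iUnion
    (fun K => Box.Icc (T.cell K)) K)) (isOpen_boxIoo _)

theorem subset_iUnion_Icc_cell (T : RectMesh Ω) : Ω ⊆ ⋃ K, Box.Icc (T.cell K) := by
  conv_lhs => rw [T.interior_union]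
  exact interior_subset

theorem upper_le_lower_of_mem_Ioo (T : RectMesh Ω) {j : Fin (n + 1)} {y : Fin n → ℝ}
    {K K' : Fin T.numCells} (hne : K ≠ K') (hK : y ∈ Box.Ioo ((T.cell K).face j))
    (hK' : y ∈ Box.Ioo ((T.cell K').face j)) :
    (T.cell K).upper j ≤ (T.cell K').lower j ∨ (T.cell K').upper j ≤ (T.cell K).lower j := by
  by_contra! h
  obtain ⟨t, ht1, ht2⟩ := exists_between (max_lt (lt_min ((T.cell K).lower_lt_upper j) h.2)
    (lt_min h.1 ((T.cell K').lower_lt_upper j)))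
  rw [max_lt_iff] at ht1
  rw [lt_min_iff] at ht2
  exact Set.disjoint_left.mp (T.disjoint_cells K K' hne)
    (insertNth_mem_Ioo.mpr ⟨⟨ht1.1, ht2.1⟩, hK⟩) (insertNth_mem_Ioo.mpr ⟨⟨ht1.2, ht2.2⟩, hK'⟩)

/-- The open set `U` straddles the interface and is covered by the two closed cells, so it lies in
the interior of the union of cells. Hence an end of a cell on an interface is never a Dirichlet
point. -/
theorem insertNth_upper_mem (T : RectMesh Ω) {j : Fin (n + 1)} {y : Fin n → ℝ}
    {K₁ K₂ : Fin T.numCells} (h : (T.cell K₁).upper j = (T.cell K₂).lower j)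
    (h₁ : y ∈ Box.Ioo ((T.cell K₁).face j)) (h₂ : y ∈ Box.Ioo ((T.cell K₂).face j)) :
    (j.insertNth ((T.cell K₁).upper j) y : Fin (n + 1) → ℝ) ∈ Ω := by
  set U : Set (Fin (n + 1) → ℝ) := {x | x j ∈ Set.Ioo ((T.cell K₁).lower j) ((T.cell K₂).upper j) ∧
    j.removeNth x ∈ Box.Ioo ((T.cell K₁).face j) ∩ Box.Ioo ((T.cell K₂).face j)} with hU
  have hopen : IsOpen U := by
    refine (isOpen_Ioo.preimage (continuous_apply j)).inter
      (((isOpen_boxIoo _).inter (isOpen_boxIoo _)).preimage ?_)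
    exact continuous_pi fun i => continuous_apply (j.succAbove i)
  have hsub : U ⊆ ⋃ K, Box.Icc (T.cell K) := by
    rintro x ⟨hx, hx₁, hx₂⟩
    rw [← Fin.insertNth_self_removeNth j x, Set.mem_iUnion]
    rcases le_total (x j) ((T.cell K₁).upper j) with hle | hle
    · exact ⟨K₁, insertNth_mem_Icc.mpr ⟨⟨hx.1.le, hle⟩, Box.Ioo_subset_Icc _ hx₁⟩⟩
    · exact ⟨K₂, insertNth_mem_Icc.mpr ⟨⟨h ▸ hle, hx.2.le⟩, Box.Ioo_subset_Icc _ hx₂⟩⟩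
  refine T.interior_union.symm.subset (interior_maximal hsub hopen ⟨?_, ?_⟩)
  · simp only [Fin.insertNth_apply_same]
    exact ⟨(T.cell K₁).lower_lt_upper j, h ▸ (T.cell K₂).lower_lt_upper j⟩
  · simpa using ⟨h₁, h₂⟩

theorem lineAdjacent_iff {j : Fin (n + 1)} {y : Fin n → ℝ} (hy : T.Generic j y)
    {K₁ K₂ : Fin T.numCells} : T.LineAdjacent j y K₁ K₂ ↔
      y ∈ Box.Ioo ((T.cell K₁).face j) ∧ y ∈ Box.Ioo ((T.cell K₂).face j) ∧
        (T.cell K₁).upper j = (T.cell K₂).lower j :=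
  ⟨fun h => ⟨hy _ h.2.1, hy _ h.2.2, h.1.1⟩, fun h => ⟨⟨h.2.2, y, h.1, h.2.1⟩,
    Box.Ioo_subset_Icc _ h.1, Box.Ioo_subset_Icc _ h.2.1⟩⟩

theorem LineAdjacent.right_unique {j : Fin (n + 1)} {y : Fin n → ℝ} (hy : T.Generic j y)
    {K K₁ K₂ : Fin T.numCells} (h₁ : T.LineAdjacent j y K K₁) (h₂ : T.LineAdjacent j y K K₂) :
    K₁ = K₂ := by
  rw [lineAdjacent_iff hy] at h₁ h₂
  by_contra hne
  rcases T.upper_le_lower_of_mem_Ioo hne h₁.2.1 h₂.2.1 with h | h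
  · linarith [(T.cell K₁).lower_lt_upper j]
  · linarith [(T.cell K₂).lower_lt_upper j]

theorem LineAdjacent.left_unique {j : Fin (n + 1)} {y : Fin n → ℝ} (hy : T.Generic j y)
    {K K₁ K₂ : Fin T.numCells} (h₁ : T.LineAdjacent j y K₁ K) (h₂ : T.LineAdjacent j y K₂ K) :
    K₁ = K₂ := by
  rw [lineAdjacent_iff hy] at h₁ h₂
  by_contra hne
  rcases T.upper_le_lower_of_mem_Ioo hne h₁.1 h₂.1 with h | h
  · linarith [(T.cell K₂).lower_lt_upper j]
  · linarith [(T.cell K₁).lower_lt_upper j]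

theorem notMem_of_subset_frontier {Γ : Set (Fin (n + 1) → ℝ)} (hΩ : IsOpen Ω)
    (hΓ : Γ ⊆ frontier Ω) {x : Fin (n + 1) → ℝ} (hx : x ∈ Γ) : x ∉ Ω := fun h =>
  (hΩ.frontier_eq ▸ hΓ hx : x ∈ closure Ω \ Ω).2 h

open Classical in
/-- Each end of a cell on a generic line lies on at most one interface or on the Dirichlet part. -/
theorem sum_lineAdjacent_le {Γ : Set (Fin (n + 1) → ℝ)} (hΩ : IsOpen Ω) (hΓ : Γ ⊆ frontier Ω)
    {j : Fin (n + 1)} {y : Fin n → ℝ} (hy : T.Generic j y) {X : Fin T.numCells → ℝ}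
    (hX : ∀ K, 0 ≤ X K) :
    (∑ K, ∑ K', if T.LineAdjacent j y K K' then X K + X K' else 0)
      + (∑ K, ∑ s, if y ∈ T.faceIn Γ K j s then X K else 0) ≤ 2 * ∑ K, X K := by
  refine sum_adjacent_add_sum_ends_le (adj := T.LineAdjacent j y)
    (ends := fun K s => y ∈ T.faceIn Γ K j s) hX (fun K => ?_) (fun K => ?_)
  · refine sum_ite_add_ite_le_one (fun K₁ K₂ h₁ h₂ => h₁.right_unique hy h₂) fun K' h hmem => ?_
    rw [lineAdjacent_iff hy] at h
    exact notMem_of_subset_frontier hΩ hΓ hmem.2 (T.insertNth_upper_mem h.2.2 h.1 h.2.1)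
  · refine sum_ite_add_ite_le_one (P := fun K' => T.LineAdjacent j y K' K)
      (fun K₁ K₂ h₁ h₂ => h₁.left_unique hy h₂) fun K' h hmem => ?_
    rw [lineAdjacent_iff hy] at h
    have := T.insertNth_upper_mem h.2.2 h.1 h.2.1
    rw [h.2.2] at this
    exact notMem_of_subset_frontier hΩ hΓ hmem.2 this

/-! ### Coercivity -/

/-- The squared energy norm: broken gradient, scaled jumps and scaled Dirichlet trace. -/
def energy (Γ : Set (Fin (n + 1) → ℝ)) (v : T.Space k) : ℝ :=
  T.meshSum Γ (fun K j x => d1 v K j x ^ 2)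
    (fun K₁ K₂ j x => jump v K₁ K₂ x ^ 2 / T.hInterface K₁ K₂ j)
    (fun K j _ x => val v K x ^ 2 / width (T.cell K) j)

/-- The contribution of a line to the energy. -/
def lineEnergy (Γ : Set (Fin (n + 1) → ℝ)) (v : T.Space k) (j : Fin (n + 1)) (y : Fin n → ℝ) : ℝ :=
  T.lineSum Γ (fun K j x => d1 v K j x ^ 2)
    (fun K₁ K₂ j x => jump v K₁ K₂ x ^ 2 / T.hInterface K₁ K₂ j)
    (fun K j _ x => val v K x ^ 2 / width (T.cell K) j) j y

/-- The contribution of a line to `formA ΓD β₀ β₁ v v`. -/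
def lineForm (Γ : Set (Fin (n + 1) → ℝ)) (β₀ β₁ : ℝ) (v : T.Space k) (j : Fin (n + 1))
    (y : Fin n → ℝ) : ℝ :=
  T.lineSum Γ (fun K j x => d1 v K j x * d1 v K j x)
    (fun K₁ K₂ j x =>
      flux β₀ β₁ v K₁ K₂ j x * jump v K₁ K₂ x + avgD1 v K₁ K₂ j x * jump v K₁ K₂ x)
    (fun K j s x => (β₀ / width (T.cell K) j * val v K x - normalSign s * d1 v K j x) * val v K x
        - val v K x * (normalSign s * d1 v K j x)) j y

@[fun_prop]
theorem continuous_jump (v : T.Space k) (K₁ K₂ : Fin T.numCells) : Continuous (jump v K₁ K₂) := by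
  unfold jump
  fun_prop

@[fun_prop]
theorem continuous_avgD1 (v : T.Space k) (K₁ K₂ : Fin T.numCells) (j : Fin (n + 1)) :
    Continuous (avgD1 v K₁ K₂ j) := by
  unfold avgD1
  fun_prop

@[fun_prop]
theorem continuous_flux (β₀ β₁ : ℝ) (v : T.Space k) (K₁ K₂ : Fin T.numCells) (j : Fin (n + 1)) :
    Continuous (flux β₀ β₁ v K₁ K₂ j) := by
  unfold flux jumpD2
  fun_prop

theorem energy_eq {Γ : Set (Fin (n + 1) → ℝ)} (hΓ : MeasurableSet Γ) (v : T.Space k) :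
    (∀ j, Integrable (lineEnergy Γ v j)) ∧ energy Γ v = ∑ j, ∫ y, lineEnergy Γ v j y :=
  T.meshSum_eq_sum_integral_lineSum (f := fun K j x => d1 v K j x ^ 2)
    (g := fun K₁ K₂ j x => jump v K₁ K₂ x ^ 2 / T.hInterface K₁ K₂ j)
    (h := fun K j _ x => val v K x ^ 2 / width (T.cell K) j) hΓ
    (fun K j => by fun_prop) (fun K₁ K₂ j => by fun_prop) (fun K j s => by fun_prop)

theorem formA_self_eq {Γ : Set (Fin (n + 1) → ℝ)} (hΓ : MeasurableSet Γ) (β₀ β₁ : ℝ)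
    (v : T.Space k) :
    (∀ j, Integrable (lineForm Γ β₀ β₁ v j)) ∧
      formA Γ β₀ β₁ v v = ∑ j, ∫ y, lineForm Γ β₀ β₁ v j y :=
  T.meshSum_eq_sum_integral_lineSum (f := fun K j x => d1 v K j x * d1 v K j x)
    (g := fun K₁ K₂ j x =>
      flux β₀ β₁ v K₁ K₂ j x * jump v K₁ K₂ x + avgD1 v K₁ K₂ j x * jump v K₁ K₂ x)
    (h := fun K j s x =>
      (β₀ / width (T.cell K) j * val v K x - normalSign s * d1 v K j x) * val v K x
        - val v K x * (normalSign s * d1 v K j x)) hΓ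
    (fun K j => by fun_prop) (fun K₁ K₂ j => by fun_prop) (fun K j s => by fun_prop)

theorem integral_d1_sq_nonneg (v : T.Space k) (K : Fin T.numCells) (j : Fin (n + 1))
    (y : Fin n → ℝ) :
    0 ≤ ∫ t in (T.cell K).lower j..(T.cell K).upper j, d1 v K j (j.insertNth t y) ^ 2 :=
  intervalIntegral.integral_nonneg ((T.cell K).lower_lt_upper j).le fun _ _ => sq_nonneg _

/-- The constant `βs` dominates the trace constants of all cells next to an interface whose mean
width is `t` times the width of the cell. -/
def Dominates (k : ℕ) (β₁ κ βs : ℝ) : Prop :=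
  2 * Gam k 0 ≤ βs ∧
    ∀ t, 0 < t → t ≤ (1 + κ) / 2 → (κ = 1 → t = 1) → t * Gam k (t * β₁) ≤ βs

theorem hInterface_div_width {κ : ℝ} {w₁ w₂ : ℝ} (h₁ : 0 < w₁) (h₂ : 0 < w₂) (hw₁ : w₁ ≤ κ * w₂)
    (hw₂ : w₂ ≤ κ * w₁) : 0 < (w₁ + w₂) / 2 / w₁ ∧ (w₁ + w₂) / 2 / w₁ ≤ (1 + κ) / 2 ∧
      (κ = 1 → (w₁ + w₂) / 2 / w₁ = 1) := by
  refine ⟨by positivity, ?_, fun h => ?_⟩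
  · rw [div_le_iff₀ h₁]; linarith
  · subst h
    rw [div_eq_one_iff_eq h₁.ne']
    linarith

theorem interface_le_right {β₁ κ βs : ℝ} (hD : Dominates k β₁ κ βs) {p : ℝ[X]}
    (hp : p.degree < k) {a b t h : ℝ} (hab : a < b) (ht : 0 < t) (htκ : t ≤ (1 + κ) / 2)
    (ht1 : κ = 1 → t = 1) (hh : h = t * (b - a)) :
    h * (p.eval b - β₁ * h * (derivative p).eval b) ^ 2 ≤ βs * ∫ x in a..b, p.eval x ^ 2 := by
  have hI : 0 ≤ ∫ x in a..b, p.eval x ^ 2 :=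
    intervalIntegral.integral_nonneg hab.le fun _ _ => sq_nonneg _
  calc h * (p.eval b - β₁ * h * (derivative p).eval b) ^ 2
      = t * ((b - a) * (p.eval b - t * β₁ * ((b - a) * (derivative p).eval b)) ^ 2) := by
        rw [hh]; ring
    _ ≤ t * (Gam k (t * β₁) * ∫ x in a..b, p.eval x ^ 2) := by
        exact mul_le_mul_of_nonneg_left (width_mul_sq_right_le hp _ hab) ht.le
    _ = t * Gam k (t * β₁) * ∫ x in a..b, p.eval x ^ 2 := by ring
    _ ≤ _ := by
        gcongr
        exact hD.2 t ht htκ ht1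

theorem interface_le_left {β₁ κ βs : ℝ} (hD : Dominates k β₁ κ βs) {p : ℝ[X]}
    (hp : p.degree < k) {a b t h : ℝ} (hab : a < b) (ht : 0 < t) (htκ : t ≤ (1 + κ) / 2)
    (ht1 : κ = 1 → t = 1) (hh : h = t * (b - a)) :
    h * (p.eval a + β₁ * h * (derivative p).eval a) ^ 2 ≤ βs * ∫ x in a..b, p.eval x ^ 2 := by
  have hI : 0 ≤ ∫ x in a..b, p.eval x ^ 2 :=
    intervalIntegral.integral_nonneg hab.le fun _ _ => sq_nonneg _
  calc h * (p.eval a + β₁ * h * (derivative p).eval a) ^ 2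
      = t * ((b - a) * (p.eval a + t * β₁ * ((b - a) * (derivative p).eval a)) ^ 2) := by
        rw [hh]; ring
    _ ≤ t * (Gam k (t * β₁) * ∫ x in a..b, p.eval x ^ 2) := by
        exact mul_le_mul_of_nonneg_left (width_mul_sq_left_le hp _ hab) ht.le
    _ = t * Gam k (t * β₁) * ∫ x in a..b, p.eval x ^ 2 := by ring
    _ ≤ _ := by
        gcongr
        exact hD.2 t ht htκ ht1

/-- Flux and symmetrizing term together are `β₀ J² / h + J (P₁ + P₂)`, where `P₁ = ∂v - β₁ h ∂²v`
from the lower cell and `P₂ = ∂v + β₁ h ∂²v` from the upper one. Each is an endpoint functional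
covered by the trace inequality, with `h` equal to `t` times the width of its cell. -/
theorem interface_term_ge {β₀ β₁ κ βs β' : ℝ} (hT : T.RatioBound κ) (hD : Dominates k β₁ κ βs)
    (hβ' : 0 < β') (v : T.Space k) {j : Fin (n + 1)} {y : Fin n → ℝ} {K₁ K₂ : Fin T.numCells}
    (hadj : Adjacent (T.cell K₁) (T.cell K₂) j) :
    (β₀ - β') * (jump v K₁ K₂ (facePoint (T.cell K₁) j true y) ^ 2 / T.hInterface K₁ K₂ j)
      - βs / β' / 2 *
        ((∫ t in (T.cell K₁).lower j..(T.cell K₁).upper j, d1 v K₁ j (j.insertNth t y) ^ 2)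
          + ∫ t in (T.cell K₂).lower j..(T.cell K₂).upper j, d1 v K₂ j (j.insertNth t y) ^ 2)
      ≤ flux β₀ β₁ v K₁ K₂ j (facePoint (T.cell K₁) j true y)
          * jump v K₁ K₂ (facePoint (T.cell K₁) j true y)
        + avgD1 v K₁ K₂ j (facePoint (T.cell K₁) j true y)
          * jump v K₁ K₂ (facePoint (T.cell K₁) j true y) := by
  set h := T.hInterface K₁ K₂ j with hh
  have hw := hT K₁ K₂ j hadj
  have hw₁ := width_pos (T.cell K₁) j
  have hw₂ := width_pos (T.cell K₂) j
  obtain ⟨ht, htκ, ht1⟩ := hInterface_div_width hw₁ hw₂ hw.1 hw.2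
  obtain ⟨ht', htκ', ht1'⟩ := hInterface_div_width hw₂ hw₁ hw.2 hw.1
  have h₁ := interface_le_right hD (degree_derivative_linePoly_lt j y (v K₁))
    ((T.cell K₁).lower_lt_upper j) ht htκ ht1 (h := h)
    (by change _ = _ * width (T.cell K₁) j; rw [div_mul_cancel₀ _ hw₁.ne', hh, hInterface])
  have h₂ := interface_le_left hD (degree_derivative_linePoly_lt j y (v K₂))
    ((T.cell K₂).lower_lt_upper j) ht' htκ' ht1' (h := h)
    (by change _ = _ * width (T.cell K₂) j
        rw [div_mul_cancel₀ _ hw₂.ne', hh, hInterface, add_comm])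
  rw [← hadj.1] at h₂
  simp only [← line.eq_1, ← d1_insertNth, ← d2_insertNth] at h₁ h₂
  rw [hadj.1] at h₂
  have key := interface_bound (β₀ := β₀) (J := jump v K₁ K₂ (facePoint (T.cell K₁) j true y))
    hβ' (hInterface_pos T K₁ K₂ j) h₁ h₂
  refine key.trans (le_of_eq ?_)
  simp only [flux, avgD1, jumpD2, facePoint, faceCoord, ← hh, if_true, hadj.1]
  ring

theorem boundary_term_ge {β₀ β₁ κ βs β' : ℝ} (hD : Dominates k β₁ κ βs) (hβ' : 0 < β')
    (v : T.Space k) (K : Fin T.numCells) (j : Fin (n + 1)) (s : Bool) (y : Fin n → ℝ) :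
    (β₀ - β') * (val v K (facePoint (T.cell K) j s y) ^ 2 / width (T.cell K) j)
      - βs / β' / 2 * ∫ t in (T.cell K).lower j..(T.cell K).upper j, d1 v K j (j.insertNth t y) ^ 2
      ≤ (β₀ / width (T.cell K) j * val v K (facePoint (T.cell K) j s y)
          - normalSign s * d1 v K j (facePoint (T.cell K) j s y))
            * val v K (facePoint (T.cell K) j s y)
        - val v K (facePoint (T.cell K) j s y)
          * (normalSign s * d1 v K j (facePoint (T.cell K) j s y)) := by
  have hp := degree_derivative_linePoly_lt j y (v K)
  have hab := (T.cell K).lower_lt_upper j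
  have hI := integral_d1_sq_nonneg v K j y
  have htr : width (T.cell K) j * d1 v K j (facePoint (T.cell K) j s y) ^ 2 ≤ Gam k 0 *
      ∫ t in (T.cell K).lower j..(T.cell K).upper j, d1 v K j (j.insertNth t y) ^ 2 := by
    have hl := width_mul_sq_left_le hp 0 hab
    have hr := width_mul_sq_right_le hp 0 hab
    simp only [← line.eq_1, ← d1_insertNth, zero_mul, add_zero, sub_zero] at hl hr
    cases s
    · simpa [facePoint, faceCoord, width] using hl
    · simpa [facePoint, faceCoord, width] using hr
  have hN : (normalSign s * d1 v K j (facePoint (T.cell K) j s y)) ^ 2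
      = d1 v K j (facePoint (T.cell K) j s y) ^ 2 := by
    cases s <;> simp [normalSign]
  have key := boundary_bound (β₀ := β₀) (βs := βs) (V := val v K (facePoint (T.cell K) j s y))
    (N := normalSign s * d1 v K j (facePoint (T.cell K) j s y)) hβ' (width_pos (T.cell K) j)
    (I := ∫ t in (T.cell K).lower j..(T.cell K).upper j, d1 v K j (j.insertNth t y) ^ 2)
    (by rw [hN]; nlinarith [hD.1])
  refine key.trans (le_of_eq ?_)
  ring

/-- Every interface and Dirichlet face keeps the share `β₀ - β'` of its penalty and charges `βs / (2
β')` of the gradient integral to each adjacent cell. With at most two charges per cell, the share `1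
- βs / β'` of the gradient is left. -/
theorem lineForm_ge {β₀ β₁ κ βs β' γ : ℝ} {Γ : Set (Fin (n + 1) → ℝ)} (hΩ : IsOpen Ω)
    (hΓ : Γ ⊆ frontier Ω) (hT : T.RatioBound κ) (hD : Dominates k β₁ κ βs) (hβ' : 0 < β')
    (hγ : γ ≤ 1 - βs / β') (hγ' : γ ≤ β₀ - β') (v : T.Space k) {j : Fin (n + 1)} {y : Fin n → ℝ}
    (hy : T.Generic j y) : γ * lineEnergy Γ v j y ≤ lineForm Γ β₀ β₁ v j y := by
  classical
  set I : Fin T.numCells → ℝ := fun K => if y ∈ Box.Icc ((T.cell K).face j) then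
    ∫ t in (T.cell K).lower j..(T.cell K).upper j, d1 v K j (j.insertNth t y) ^ 2 else 0 with hI
  have hI0 : ∀ K, 0 ≤ I K := fun K => by
    simp only [hI]
    split_ifs
    exacts [integral_d1_sq_nonneg v K j y, le_rfl]
  have hIK : ∀ K, y ∈ Box.Icc ((T.cell K).face j) →
      ∫ t in (T.cell K).lower j..(T.cell K).upper j, d1 v K j (j.insertNth t y) ^ 2 = I K :=
    fun K hK => by simp only [hI, if_pos hK]
  have hcount := sum_lineAdjacent_le hΩ hΓ hy hI0
  have hθ : 0 ≤ βs / β' / 2 := by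
    have := hD.1
    have := Gam_nonneg k 0
    have : 0 ≤ βs := by linarith
    positivity
  simp only [lineEnergy, lineForm, lineSum]
  have h1 : (∑ K, if y ∈ Box.Icc ((T.cell K).face j) then
      ∫ t in (T.cell K).lower j..(T.cell K).upper j,
        d1 v K j (j.insertNth t y) * d1 v K j (j.insertNth t y) else 0) = ∑ K, I K := by
    simp only [hI, sq]
  have h2 : ∀ K₁ K₂, γ * (if T.LineAdjacent j y K₁ K₂ then
        jump v K₁ K₂ (facePoint (T.cell K₁) j true y) ^ 2 / T.hInterface K₁ K₂ j else 0)
      - βs / β' / 2 * (if T.LineAdjacent j y K₁ K₂ then I K₁ + I K₂ else 0)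
      ≤ if T.LineAdjacent j y K₁ K₂ then
          flux β₀ β₁ v K₁ K₂ j (facePoint (T.cell K₁) j true y)
            * jump v K₁ K₂ (facePoint (T.cell K₁) j true y)
          + avgD1 v K₁ K₂ j (facePoint (T.cell K₁) j true y)
            * jump v K₁ K₂ (facePoint (T.cell K₁) j true y) else 0 := by
    intro K₁ K₂
    by_cases hadj : T.LineAdjacent j y K₁ K₂
    · simp only [if_pos hadj]
      have h := interface_term_ge (β₀ := β₀) hT hD hβ' v (y := y) hadj.1
      rw [hIK K₁ hadj.2.1, hIK K₂ hadj.2.2] at h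
      refine le_trans (sub_le_sub_right (mul_le_mul_of_nonneg_right hγ' ?_) _) h
      exact div_nonneg (sq_nonneg _) (hInterface_pos T K₁ K₂ j).le
    · simp [hadj]
  have h3 : ∀ K s, γ * (if y ∈ T.faceIn Γ K j s then
        val v K (facePoint (T.cell K) j s y) ^ 2 / width (T.cell K) j else 0)
      - βs / β' / 2 * (if y ∈ T.faceIn Γ K j s then I K else 0)
      ≤ if y ∈ T.faceIn Γ K j s then
          (β₀ / width (T.cell K) j * val v K (facePoint (T.cell K) j s y)
            - normalSign s * d1 v K j (facePoint (T.cell K) j s y))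
              * val v K (facePoint (T.cell K) j s y)
          - val v K (facePoint (T.cell K) j s y)
            * (normalSign s * d1 v K j (facePoint (T.cell K) j s y)) else 0 := by
    intro K s
    by_cases hmem : y ∈ T.faceIn Γ K j s
    · simp only [if_pos hmem]
      have h := boundary_term_ge (β₀ := β₀) hD hβ' v K j s y
      rw [hIK K hmem.1] at h
      refine le_trans (sub_le_sub_right (mul_le_mul_of_nonneg_right hγ' ?_) _) h
      exact div_nonneg (sq_nonneg _) (width_pos _ j).le
    · simp [hmem]
  have h2' := Finset.sum_le_sum fun K₁ (_ : K₁ ∈ Finset.univ) =>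
    Finset.sum_le_sum fun K₂ (_ : K₂ ∈ Finset.univ) => h2 K₁ K₂
  have h3' := Finset.sum_le_sum fun K (_ : K ∈ Finset.univ) =>
    Finset.sum_le_sum fun s (_ : s ∈ Finset.univ) => h3 K s
  simp only [Finset.sum_sub_distrib, ← Finset.mul_sum] at h2' h3'
  rw [h1, mul_add, mul_add]
  have hsum : γ * ∑ K, I K ≤ ∑ K, I K - βs / β' / 2 * (2 * ∑ K, I K) := by
    have := mul_le_mul_of_nonneg_right hγ (Finset.sum_nonneg fun K (_ : K ∈ Finset.univ) => hI0 K)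
    linarith
  have hcount' := mul_le_mul_of_nonneg_left hcount hθ
  rw [mul_add] at hcount'
  change γ * ∑ K, I K + _ + _ ≤ _
  linarith

theorem formA_self_ge {β₀ β₁ κ βs β' γ : ℝ} {Γ : Set (Fin (n + 1) → ℝ)} (hΩ : IsOpen Ω)
    (hΓ : Γ ⊆ frontier Ω) (hΓm : MeasurableSet Γ) (hT : T.RatioBound κ)
    (hD : Dominates k β₁ κ βs) (hβ' : 0 < β') (hγ : γ ≤ 1 - βs / β') (hγ' : γ ≤ β₀ - β')
    (v : T.Space k) : γ * energy Γ v ≤ formA Γ β₀ β₁ v v := by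
  rw [(energy_eq hΓm v).2, (formA_self_eq hΓm β₀ β₁ v).2, Finset.mul_sum]
  refine Finset.sum_le_sum fun j _ => ?_
  rw [← integral_const_mul]
  refine integral_mono_ae (((energy_eq hΓm v).1 j).const_mul γ) ((formA_self_eq hΓm β₀ β₁ v).1 j) ?_
  filter_upwards [T.ae_generic j] with y hy
  exact lineForm_ge hΩ hΓ hT hD hβ' hγ hγ' v hy

/-! ### The square of a piecewise polynomial as a function on the whole space -/

/-- The square of the piecewise polynomial `v`, set to zero outside the open cells. -/
def sqDensity (v : T.Space k) (x : Fin (n + 1) → ℝ) : ℝ :=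
  ∑ K, (Box.Ioo (T.cell K)).indicator (fun x => val v K x ^ 2) x

theorem sqDensity_nonneg (v : T.Space k) (x : Fin (n + 1) → ℝ) : 0 ≤ sqDensity v x :=
  Finset.sum_nonneg fun _ _ => Set.indicator_nonneg (fun _ _ => sq_nonneg _) _

theorem sqDensity_eq_of_mem (v : T.Space k) {K : Fin T.numCells} {x : Fin (n + 1) → ℝ}
    (hx : x ∈ Box.Ioo (T.cell K)) : sqDensity v x = val v K x ^ 2 := by
  rw [sqDensity, Finset.sum_eq_single K, Set.indicator_of_mem hx]
  · intro K' _ hne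
    exact Set.indicator_of_notMem
      (fun h => Set.disjoint_left.mp (T.disjoint_cells K' K hne) h hx) _
  · simp

theorem sqDensity_eq_zero (v : T.Space k) {x : Fin (n + 1) → ℝ} (hx : x ∉ Ω) :
    sqDensity v x = 0 :=
  Finset.sum_eq_zero fun K _ => Set.indicator_of_notMem (fun h => hx (T.Ioo_cell_subset K h)) _

theorem integrableOn_val_sq (v : T.Space k) (K : Fin T.numCells) :
    IntegrableOn (fun x => val v K x ^ 2) (Box.Icc (T.cell K)) :=
  ((continuous_val v K).pow 2).continuousOn.integrableOn_compact (Box.isCompact_Icc _)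

theorem integrable_sqDensity (v : T.Space k) : Integrable (sqDensity v) :=
  integrable_finsetSum _ fun K _ => (integrable_indicator_iff (isOpen_boxIoo _).measurableSet).mpr
    ((integrableOn_val_sq v K).mono_set (Box.Ioo_subset_Icc _))

theorem integral_sqDensity (v : T.Space k) :
    ∫ x, sqDensity v x = ∑ K, ∫ x in Box.Icc (T.cell K), val v K x ^ 2 := by
  simp only [sqDensity]
  rw [integral_finsetSum _ fun K _ =>
    (integrable_indicator_iff (isOpen_boxIoo _).measurableSet).mpr
      ((integrableOn_val_sq v K).mono_set (Box.Ioo_subset_Icc _))]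
  refine Finset.sum_congr rfl fun K _ => ?_
  rw [integral_indicator (isOpen_boxIoo _).measurableSet]
  exact setIntegral_congr_set (Box.Ioo_ae_eq_Icc _)

theorem integrable_sqDensity_line (v : T.Space k) (j : Fin (n + 1)) (y : Fin n → ℝ) :
    Integrable fun t => sqDensity v (j.insertNth t y) := by
  refine integrable_finsetSum _ fun K _ => ?_
  have hc : Continuous fun t : ℝ => (j.insertNth t y : Fin (n + 1) → ℝ) :=
    (continuous_insertNth j).comp (continuous_id.prodMk continuous_const)
  change Integrable (((fun t : ℝ => (j.insertNth t y : Fin (n + 1) → ℝ)) ⁻¹'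
    Box.Ioo (T.cell K)).indicator fun t => val v K (j.insertNth t y) ^ 2)
  rw [integrable_indicator_iff ((isOpen_boxIoo _).preimage hc).measurableSet]
  refine IntegrableOn.mono_set ((((continuous_val v K).comp hc).pow 2).continuousOn.integrableOn_compact
    isCompact_Icc) (fun t ht => ?_ : _ ⊆ Set.Icc ((T.cell K).lower j) ((T.cell K).upper j))
  have := (insertNth_mem_Ioo.mp ht).1
  exact ⟨this.1.le, this.2.le⟩

/-- `t` is not the coordinate of a face of a cell. -/
def OffFaces (T : RectMesh Ω) (j : Fin (n + 1)) (t : ℝ) : Prop :=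
  ∀ K, t ≠ (T.cell K).lower j ∧ t ≠ (T.cell K).upper j

theorem ae_offFaces (T : RectMesh Ω) (j : Fin (n + 1)) : ∀ᵐ t, T.OffFaces j t := by
  simp only [OffFaces, ae_all_iff]
  exact fun K => (Measure.ae_ne volume _).and (Measure.ae_ne volume _)

theorem exists_cell_Icc {j : Fin (n + 1)} {y : Fin n → ℝ} (hy : T.Generic j y) {t : ℝ}
    (ht : (j.insertNth t y : Fin (n + 1) → ℝ) ∈ Ω) :
    ∃ K, y ∈ Box.Ioo ((T.cell K).face j) ∧ t ∈ Set.Icc ((T.cell K).lower j) ((T.cell K).upper j) := by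
  obtain ⟨K, hK⟩ := Set.mem_iUnion.mp (T.subset_iUnion_Icc_cell ht)
  exact ⟨K, hy K (insertNth_mem_Icc.mp hK).2, (insertNth_mem_Icc.mp hK).1⟩

theorem exists_cell_Ioo {j : Fin (n + 1)} {y : Fin n → ℝ} (hy : T.Generic j y) {t : ℝ}
    (htf : T.OffFaces j t) (ht : (j.insertNth t y : Fin (n + 1) → ℝ) ∈ Ω) (v : T.Space k) :
    ∃ K, y ∈ Box.Ioo ((T.cell K).face j) ∧ t ∈ Set.Ioo ((T.cell K).lower j) ((T.cell K).upper j) ∧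
      sqDensity v (j.insertNth t y) = (line v K j y).eval t ^ 2 := by
  obtain ⟨K, hK, htK⟩ := exists_cell_Icc hy ht
  have htK' : t ∈ Set.Ioo ((T.cell K).lower j) ((T.cell K).upper j) :=
    ⟨lt_of_le_of_ne htK.1 (htf K).1.symm, lt_of_le_of_ne htK.2 (htf K).2⟩
  refine ⟨K, hK, htK', ?_⟩
  rw [sqDensity_eq_of_mem v (insertNth_mem_Ioo.mpr ⟨htK', hK⟩), val_insertNth]

/-! ### Variation along a line -/

open Classical in
theorem lineEnergy_eq (Γ : Set (Fin (n + 1) → ℝ)) (v : T.Space k) (j : Fin (n + 1))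
    (y : Fin n → ℝ) :
    lineEnergy Γ v j y = (∑ K, if y ∈ Box.Icc ((T.cell K).face j) then
      ∫ t in (T.cell K).lower j..(T.cell K).upper j, (derivative (line v K j y)).eval t ^ 2 else 0)
    + (∑ K₁, ∑ K₂, if T.LineAdjacent j y K₁ K₂ then
        ((line v K₁ j y).eval ((T.cell K₁).upper j) - (line v K₂ j y).eval ((T.cell K₁).upper j)) ^ 2
          / T.hInterface K₁ K₂ j else 0)
    + ∑ K, ∑ s, if y ∈ T.faceIn Γ K j s then
        (line v K j y).eval (faceCoord (T.cell K) j s) ^ 2 / width (T.cell K) j else 0 := by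
  simp only [lineEnergy, lineSum, d1_insertNth, jump, facePoint, val_insertNth]
  congr 2
  refine Finset.sum_congr rfl fun K₁ _ => Finset.sum_congr rfl fun K₂ _ => ?_
  rw [sub_sq_comm]
  rfl

theorem lineEnergy_nonneg (Γ : Set (Fin (n + 1) → ℝ)) (v : T.Space k) (j : Fin (n + 1))
    (y : Fin n → ℝ) : 0 ≤ lineEnergy Γ v j y := by
  classical
  simp only [lineEnergy, lineSum]
  refine add_nonneg (add_nonneg ?_ ?_) ?_
  · refine Finset.sum_nonneg fun K _ => ?_
    split_ifs
    exacts [integral_d1_sq_nonneg v K j y, le_rfl]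
  · refine Finset.sum_nonneg fun K₁ _ => Finset.sum_nonneg fun K₂ _ => ?_
    split_ifs
    exacts [div_nonneg (sq_nonneg _) (hInterface_pos T K₁ K₂ j).le, le_rfl]
  · refine Finset.sum_nonneg fun K _ => Finset.sum_nonneg fun s _ => ?_
    split_ifs
    exacts [div_nonneg (sq_nonneg _) (width_pos _ j).le, le_rfl]

theorem integral_lineEnergy_le {Γ : Set (Fin (n + 1) → ℝ)} (hΓ : MeasurableSet Γ) (v : T.Space k)
    (j : Fin (n + 1)) (u : Set (Fin n → ℝ)) : ∫ y in u, lineEnergy Γ v j y ≤ energy Γ v := by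
  calc ∫ y in u, lineEnergy Γ v j y ≤ ∫ y, lineEnergy Γ v j y :=
        setIntegral_le_integral ((energy_eq hΓ v).1 j)
          (Filter.Eventually.of_forall fun y => lineEnergy_nonneg Γ v j y)
    _ ≤ ∑ j, ∫ y, lineEnergy Γ v j y :=
        Finset.single_le_sum (f := fun j => ∫ y, lineEnergy Γ v j y)
          (fun j _ => integral_nonneg fun y => lineEnergy_nonneg Γ v j y) (Finset.mem_univ j)
    _ = energy Γ v := (energy_eq hΓ v).2.symm

theorem sq_dirichlet_le_lineEnergy {Γ : Set (Fin (n + 1) → ℝ)} (v : T.Space k) {j : Fin (n + 1)}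
    {y : Fin n → ℝ} {K : Fin T.numCells} {s : Bool} (h : y ∈ T.faceIn Γ K j s) :
    (line v K j y).eval (faceCoord (T.cell K) j s) ^ 2
      ≤ width (T.cell K) j * lineEnergy Γ v j y := by
  classical
  have hw := width_pos (T.cell K) j
  rw [mul_comm, ← div_le_iff₀ hw, lineEnergy_eq]
  have hterm : ∀ K s, 0 ≤ if y ∈ T.faceIn Γ K j s then
      (line v K j y).eval (faceCoord (T.cell K) j s) ^ 2 / width (T.cell K) j else 0 := by
    intro K s
    split_ifs
    exacts [div_nonneg (sq_nonneg _) (width_pos _ j).le, le_rfl]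
  have h1 : (line v K j y).eval (faceCoord (T.cell K) j s) ^ 2 / width (T.cell K) j
      ≤ ∑ K, ∑ s, if y ∈ T.faceIn Γ K j s then
        (line v K j y).eval (faceCoord (T.cell K) j s) ^ 2 / width (T.cell K) j else 0 := by
    refine le_trans ?_ (Finset.single_le_sum
      (fun K _ => Finset.sum_nonneg fun s _ => hterm K s) (Finset.mem_univ K))
    refine le_trans ?_ (Finset.single_le_sum (fun s _ => hterm K s) (Finset.mem_univ s))
    rw [if_pos h]
  refine h1.trans (le_add_of_nonneg_left (add_nonneg ?_ ?_))
  · refine Finset.sum_nonneg fun K _ => ?_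
    split_ifs
    · exact intervalIntegral.integral_nonneg ((T.cell K).lower_lt_upper j).le fun _ _ => sq_nonneg _
    · exact le_rfl
  · refine Finset.sum_nonneg fun K₁ _ => Finset.sum_nonneg fun K₂ _ => ?_
    split_ifs
    exacts [div_nonneg (sq_nonneg _) (hInterface_pos T K₁ K₂ j).le, le_rfl]

theorem cell_bounds {R : ℝ} (hR : ∀ x ∈ closure Ω, ∀ i, |x i| ≤ R) (T : RectMesh Ω)
    (K : Fin T.numCells) (j : Fin (n + 1)) :
    -R ≤ (T.cell K).lower j ∧ (T.cell K).upper j ≤ R := by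
  have hcl : Box.Icc (T.cell K) ⊆ closure Ω := by
    refine subset_trans ?_ (closure_mono (T.Ioo_cell_subset K))
    rw [Box.Ioo]
    change _ ⊆ closure (Set.pi Set.univ _)
    rw [closure_pi_set, Box.Icc_eq_pi]
    exact Set.pi_mono fun i _ => (closure_Ioo ((T.cell K).lower_ne_upper i)).symm.subset
  exact ⟨(abs_le.mp (hR _ (hcl (T.cell K).lower_mem_Icc) j)).1,
    (abs_le.mp (hR _ (hcl (T.cell K).upper_mem_Icc) j)).2⟩

/-- The walk from `s` to `t` collects cell variations `√(w I)` and jumps. The Cauchy–Schwarz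
inequality with weights `w` for the cells and `h_e` for the jumps produces the energy times `∑ w`
and `∑ h_e`, both at most `2R` whatever the mesh. -/
theorem sq_line_sub_le {R : ℝ} (hΩ : IsOpen Ω) (hR : ∀ x ∈ closure Ω, ∀ i, |x i| ≤ R) (hR0 : 0 ≤ R)
    (Γ : Set (Fin (n + 1) → ℝ)) (v : T.Space k) {j : Fin (n + 1)} {y : Fin n → ℝ}
    (hy : T.Generic j y) {K K' : Fin T.numCells} {s t : ℝ} (hK : y ∈ Box.Ioo ((T.cell K).face j))
    (hK' : y ∈ Box.Ioo ((T.cell K').face j))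
    (hs : s ∈ Set.Icc ((T.cell K).lower j) ((T.cell K).upper j))
    (ht : t ∈ Set.Ioc ((T.cell K').lower j) ((T.cell K').upper j)) (hst : s < t)
    (hmem : ∀ x ∈ Set.Ioo s t, (j.insertNth x y : Fin (n + 1) → ℝ) ∈ Ω) :
    ((line v K j y).eval s - (line v K' j y).eval t) ^ 2 ≤ 4 * R * lineEnergy Γ v j y := by
  classical
  set S : Finset (Fin T.numCells) := Finset.univ.filter (fun K => y ∈ Box.Ioo ((T.cell K).face j))
    with hS
  have hmS : ∀ K, K ∈ S ↔ y ∈ Box.Ioo ((T.cell K).face j) := fun K => by simp [hS]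
  set a : Fin T.numCells → ℝ := fun K => (T.cell K).lower j
  set b : Fin T.numCells → ℝ := fun K => (T.cell K).upper j
  set w : Fin T.numCells → ℝ := fun K => b K - a K
  set p : Fin T.numCells → ℝ[X] := fun K => line v K j y
  set I : Fin T.numCells → ℝ := fun K => ∫ t in a K..b K, (derivative (p K)).eval t ^ 2
  set J : Fin T.numCells → Fin T.numCells → ℝ := fun K₁ K₂ =>
    |(p K₁).eval (b K₁) - (p K₂).eval (b K₁)|
  have hw : ∀ K, 0 < w K := fun K => width_pos (T.cell K) j
  have hI : ∀ K, 0 ≤ I K := fun K =>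
    intervalIntegral.integral_nonneg ((T.cell K).lower_lt_upper j).le fun _ _ => sq_nonneg _
  have hdisj : ∀ K ∈ S, ∀ K' ∈ S, K ≠ K' → b K ≤ a K' ∨ b K' ≤ a K := fun K hK K' hK' hne =>
    T.upper_le_lower_of_mem_Ioo hne ((hmS K).mp hK) ((hmS K').mp hK')
  have hwalk := abs_sub_le_sum_variation (a := a) (b := b) (p := fun K x => (p K).eval x)
    (D := fun K => Real.sqrt (w K * I K)) (J := J) ht (fun _ _ => le_rfl) S
    (fun K _ => (T.cell K).lower_lt_upper j) hdisj
    (fun K _ s hs t ht => Real.abs_le_sqrt (sq_sub_le_width_mul (p K) hs ht))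
    (fun x hx => by
      obtain ⟨K, hK, hxK⟩ := exists_cell_Icc hy (hmem x hx)
      exact ⟨K, (hmS K).mpr hK, hxK⟩) hst ((hmS K).mpr hK) ((hmS K').mpr hK') hs
  have hadj : ∀ F : Fin T.numCells → Fin T.numCells → ℝ,
      (∑ K₁ ∈ S, ∑ K₂ ∈ S, if b K₁ = a K₂ then F K₁ K₂ else 0)
        = ∑ K₁, ∑ K₂, if T.LineAdjacent j y K₁ K₂ then F K₁ K₂ else 0 := by
    intro F
    rw [hS, Finset.sum_filter]
    refine Finset.sum_congr rfl fun K₁ _ => ?_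
    simp only [lineAdjacent_iff hy]
    split_ifs with h1
    · rw [Finset.sum_filter]
      refine Finset.sum_congr rfl fun K₂ _ => ?_
      by_cases h2 : y ∈ Box.Ioo ((T.cell K₂).face j) <;> simp [h1, h2, a, b]
    · simp [h1]
  have hlen : ∑ K ∈ S, w K ≤ 2 * R := sum_length_le hR0
    (fun K _ => ((T.cell K).lower_lt_upper j).le) hdisj (fun K _ => (cell_bounds hR T K j).1)
    (fun K _ => (cell_bounds hR T K j).2)
  have hhle : (∑ K₁, ∑ K₂, if T.LineAdjacent j y K₁ K₂ then T.hInterface K₁ K₂ j else 0)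
      ≤ 2 * R := by
    -- The counting lemma, applied to the widths with empty Dirichlet part: `2 h_e` is the sum of
    -- the two widths, so `∑ h_e ≤ ∑ w`.
    have hc := sum_lineAdjacent_le hΩ (Set.empty_subset _) hy
      (X := fun K => if y ∈ Box.Ioo ((T.cell K).face j) then w K else 0) (fun K => by
        split_ifs
        exacts [(hw K).le, le_rfl])
    have hz : (∑ K, ∑ s, if y ∈ T.faceIn ∅ K j s then
        (if y ∈ Box.Ioo ((T.cell K).face j) then w K else 0) else 0) = 0 := by
      simp [faceIn]
    have hs2 : (∑ K, if y ∈ Box.Ioo ((T.cell K).face j) then w K else 0) = ∑ K ∈ S, w K := by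
      rw [hS, Finset.sum_filter]
    have hs1 : (∑ K, ∑ K', if T.LineAdjacent j y K K' then
        (if y ∈ Box.Ioo ((T.cell K).face j) then w K else 0)
          + (if y ∈ Box.Ioo ((T.cell K').face j) then w K' else 0) else 0)
        = 2 * ∑ K₁, ∑ K₂, if T.LineAdjacent j y K₁ K₂ then T.hInterface K₁ K₂ j else 0 := by
      simp only [Finset.mul_sum]
      refine Finset.sum_congr rfl fun K₁ _ => Finset.sum_congr rfl fun K₂ _ => ?_
      by_cases h : T.LineAdjacent j y K₁ K₂
      · have h' := (lineAdjacent_iff hy).mp h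
        simp only [if_pos h, if_pos h'.1, if_pos h'.2.1, hInterface]
        change w K₁ + w K₂ = 2 * ((w K₁ + w K₂) / 2)
        ring
      · simp [h]
    rw [hz, hs2, hs1] at hc
    linarith
  set X := ∑ K ∈ S, Real.sqrt (w K * I K)
  set Y := ∑ K₁ ∈ S, ∑ K₂ ∈ S, if b K₁ = a K₂ then J K₁ K₂ else 0 with hY
  set EI := ∑ K ∈ S, I K with hEI
  set EJ := ∑ K₁, ∑ K₂, if T.LineAdjacent j y K₁ K₂ then
    ((p K₁).eval (b K₁) - (p K₂).eval (b K₁)) ^ 2 / T.hInterface K₁ K₂ j else 0 with hEJ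
  have hEI0 : 0 ≤ EI := Finset.sum_nonneg fun K _ => hI K
  have hEJterm : ∀ K₁ K₂, 0 ≤ if T.LineAdjacent j y K₁ K₂ then
      ((p K₁).eval (b K₁) - (p K₂).eval (b K₁)) ^ 2 / T.hInterface K₁ K₂ j else 0 := by
    intro K₁ K₂
    split_ifs
    exacts [div_nonneg (sq_nonneg _) (hInterface_pos T K₁ K₂ j).le, le_rfl]
  have hEJ0 : 0 ≤ EJ := Finset.sum_nonneg fun K₁ _ => Finset.sum_nonneg fun K₂ _ => hEJterm K₁ K₂
  have hX : X ^ 2 ≤ 2 * R * EI := by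
    refine (Finset.sum_sq_le_sum_mul_sum_of_sq_le_mul S (fun K _ => (hw K).le) (fun K _ => hI K)
      (fun K _ => (Real.sq_sqrt (mul_nonneg (hw K).le (hI K))).le)).trans ?_
    gcongr
  have hY2 : Y ^ 2 ≤ 2 * R * EJ := by
    rw [hY, hadj]
    have hcs := Finset.sum_sq_le_sum_mul_sum_of_sq_le_mul
      ((Finset.univ : Finset (Fin T.numCells)) ×ˢ (Finset.univ : Finset (Fin T.numCells)))
      (r := fun q => if T.LineAdjacent j y q.1 q.2 then J q.1 q.2 else 0)
      (f := fun q => if T.LineAdjacent j y q.1 q.2 then T.hInterface q.1 q.2 j else 0)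
      (g := fun q => if T.LineAdjacent j y q.1 q.2 then
        ((p q.1).eval (b q.1) - (p q.2).eval (b q.1)) ^ 2 / T.hInterface q.1 q.2 j else 0)
      (fun q _ => by
        split_ifs
        exacts [(hInterface_pos T _ _ j).le, le_rfl]) (fun q _ => hEJterm q.1 q.2) (fun q _ => by
        split_ifs
        · rw [mul_div_cancel₀ _ (hInterface_pos T _ _ j).ne', sq_abs]
        · simp)
    simp only [Finset.sum_product] at hcs
    refine hcs.trans ?_
    gcongr
  have hE : EI + EJ ≤ lineEnergy Γ v j y := by
    rw [lineEnergy_eq]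
    have h1 : EI = ∑ K, if y ∈ Box.Icc ((T.cell K).face j) then I K else 0 := by
      rw [hEI, hS, Finset.sum_filter]
      refine Finset.sum_congr rfl fun K _ => ?_
      have : y ∈ Box.Ioo ((T.cell K).face j) ↔ y ∈ Box.Icc ((T.cell K).face j) :=
        ⟨fun h => Box.Ioo_subset_Icc _ h, hy K⟩
      simp only [this]
    rw [h1]
    refine le_add_of_nonneg_right (Finset.sum_nonneg fun K _ => Finset.sum_nonneg fun s _ => ?_)
    split_ifs
    exacts [div_nonneg (sq_nonneg _) (width_pos _ j).le, le_rfl]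
  calc ((p K).eval s - (p K').eval t) ^ 2 = |(p K).eval s - (p K').eval t| ^ 2 := (sq_abs _).symm
    _ ≤ (X + Y) ^ 2 := by gcongr
    _ ≤ 2 * X ^ 2 + 2 * Y ^ 2 := by nlinarith [sq_nonneg (X - Y)]
    _ ≤ 4 * R * (EI + EJ) := by linarith
    _ ≤ _ := by gcongr

/-! ### A Poincaré–Friedrichs inequality with a constant independent of the mesh -/

theorem sq_le_two_mul_add {a b c : ℝ} (h : (a - b) ^ 2 ≤ c) : a ^ 2 ≤ 2 * b ^ 2 + 2 * c := by
  nlinarith [sq_nonneg (a - 2 * b)]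

theorem sqDensity_line_le {R : ℝ} (hΩ : IsOpen Ω) (hR : ∀ x ∈ closure Ω, ∀ i, |x i| ≤ R)
    (hR0 : 0 ≤ R) (Γ : Set (Fin (n + 1) → ℝ)) (v : T.Space k) {j : Fin (n + 1)} {y : Fin n → ℝ}
    (hy : T.Generic j y) {α β s t : ℝ} (hs : s ∈ Set.Ioo α β) (ht : t ∈ Set.Ioo α β)
    (hsf : T.OffFaces j s) (htf : T.OffFaces j t)
    (hmem : ∀ x ∈ Set.Ioo α β, (j.insertNth x y : Fin (n + 1) → ℝ) ∈ Ω) :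
    sqDensity v (j.insertNth s y)
      ≤ 2 * sqDensity v (j.insertNth t y) + 8 * R * lineEnergy Γ v j y := by
  obtain ⟨K, hK, hsK, hsq⟩ := exists_cell_Ioo hy hsf (hmem s hs) v
  obtain ⟨K', hK', htK, htq⟩ := exists_cell_Ioo hy htf (hmem t ht) v
  have hE := lineEnergy_nonneg Γ v j y
  rcases lt_trichotomy s t with hst | rfl | hst
  · have h := sq_line_sub_le hΩ hR hR0 Γ v hy hK hK' ⟨hsK.1.le, hsK.2.le⟩ ⟨htK.1, htK.2.le⟩ hst
      (fun x hx => hmem x ⟨hs.1.trans hx.1, hx.2.trans ht.2⟩)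
    rw [hsq, htq]
    linarith [sq_le_two_mul_add h]
  · have := sqDensity_nonneg v (j.insertNth s y)
    have : 0 ≤ 8 * R * lineEnergy Γ v j y := by positivity
    linarith
  · have h := sq_line_sub_le hΩ hR hR0 Γ v hy hK' hK ⟨htK.1.le, htK.2.le⟩ ⟨hsK.1, hsK.2.le⟩ hst
      (fun x hx => hmem x ⟨ht.1.trans hx.1, hx.2.trans hs.2⟩)
    rw [sub_sq_comm] at h
    rw [hsq, htq]
    linarith [sq_le_two_mul_add h]

theorem setIntegral_Ioo_le_of_forall {f : ℝ → ℝ} (hf : Integrable f) {α β c : ℝ} (hαβ : α ≤ β)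
    {P : ℝ → Prop} (hP : ∀ᵐ t, P t) (h : ∀ t ∈ Set.Ioo α β, P t → f t ≤ c) :
    ∫ t in Set.Ioo α β, f t ≤ (β - α) * c := by
  calc ∫ t in Set.Ioo α β, f t ≤ ∫ _ in Set.Ioo α β, c := by
        refine setIntegral_mono_on_ae hf.integrableOn (integrableOn_const (by simp))
          measurableSet_Ioo ?_
        filter_upwards [hP] with t ht hmem using h t hmem ht
    _ = (β - α) * c := by simp [hαβ]

theorem le_setIntegral_Ioo_of_forall {f : ℝ → ℝ} (hf : Integrable f) {α β c : ℝ} (hαβ : α ≤ β)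
    {P : ℝ → Prop} (hP : ∀ᵐ t, P t) (h : ∀ t ∈ Set.Ioo α β, P t → c ≤ f t) :
    (β - α) * c ≤ ∫ t in Set.Ioo α β, f t := by
  have := setIntegral_Ioo_le_of_forall hf.neg hαβ hP (c := -c) fun t ht hPt => neg_le_neg (h t ht hPt)
  simp only [Pi.neg_apply, MeasureTheory.integral_neg] at this
  linarith

/-- The pointwise comparison `sqDensity_line_le` integrated over `s` in the long interval and `t` in
the short one: mass on part of a segment controls the mass on all of it. -/
theorem setIntegral_sqDensity_line_le {R : ℝ} (hΩ : IsOpen Ω)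
    (hR : ∀ x ∈ closure Ω, ∀ i, |x i| ≤ R) (hR0 : 0 ≤ R) (Γ : Set (Fin (n + 1) → ℝ))
    (v : T.Space k) {j : Fin (n + 1)} {y : Fin n → ℝ} (hy : T.Generic j y) {α β α' β' : ℝ}
    (hα : α ≤ α') (hαβ : α' < β') (hβ : β' ≤ β)
    (hmem : ∀ x ∈ Set.Ioo α β, (j.insertNth x y : Fin (n + 1) → ℝ) ∈ Ω) :
    (β' - α') * ∫ t in Set.Ioo α β, sqDensity v (j.insertNth t y)
      ≤ 2 * (β - α) * (∫ t in Set.Ioo α' β', sqDensity v (j.insertNth t y))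
        + 8 * R * (β - α) * (β' - α') * lineEnergy Γ v j y := by
  set Q := ∫ t in Set.Ioo α β, sqDensity v (j.insertNth t y)
  have hL : 0 < β - α := by linarith
  have hint := integrable_sqDensity_line v j y
  have hE := lineEnergy_nonneg Γ v j y
  -- For fixed `t`, integrating over `s` gives a lower bound for the density at `t`; this bound is
  -- then integrated over `t`.
  have h := le_setIntegral_Ioo_of_forall hint hαβ.le (T.ae_offFaces j)
    (c := (Q / (β - α) - 8 * R * lineEnergy Γ v j y) / 2) (fun t ht htf => by
      have hQ : Q ≤ (β - α) * (2 * sqDensity v (j.insertNth t y) + 8 * R * lineEnergy Γ v j y) :=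
        setIntegral_Ioo_le_of_forall hint (by linarith) (T.ae_offFaces j) fun s hs hsf =>
          sqDensity_line_le hΩ hR hR0 Γ v hy hs ⟨hα.trans_lt ht.1, ht.2.trans_le hβ⟩ hsf htf hmem
      rw [← div_le_iff₀' hL] at hQ
      linarith)
  have h2 := mul_le_mul_of_nonneg_left h (by linarith : 0 ≤ 2 * (β - α))
  have e : 2 * (β - α) * ((β' - α') * ((Q / (β - α) - 8 * R * lineEnergy Γ v j y) / 2))
      = (β' - α') * Q - 8 * R * (β - α) * (β' - α') * lineEnergy Γ v j y := by
    field_simp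
  rw [e] at h2
  linarith

/-! ### Regions with mesh-independent `L²` control, and their propagation. -/

/-- The open box with corners `l` and `u`. -/
def openBox {ι : Type*} (l u : ι → ℝ) : Set (ι → ℝ) := Set.pi Set.univ fun i => Set.Ioo (l i) (u i)

theorem insertNth_mem_openBox {l u : Fin (n + 1) → ℝ} {j : Fin (n + 1)} {t : ℝ} {y : Fin n → ℝ} :
    (j.insertNth t y : Fin (n + 1) → ℝ) ∈ openBox l u ↔
      t ∈ Set.Ioo (l j) (u j) ∧ y ∈ openBox (j.removeNth l) (j.removeNth u) := by
  simp only [openBox, Set.mem_univ_pi]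
  rw [Fin.forall_iff_succAbove j]
  simp [Fin.removeNth]

theorem measurableSet_openBox {ι : Type*} [Countable ι] (l u : ι → ℝ) :
    MeasurableSet (openBox l u) :=
  MeasurableSet.univ_pi fun _ => measurableSet_Ioo

/-- On `A`, the `L²` norm of all piecewise polynomials on all meshes is controlled by the energy. -/
def Controlled (Ω Γ : Set (Fin (n + 1) → ℝ)) (k : ℕ) (A : Set (Fin (n + 1) → ℝ)) : Prop :=
  ∃ C : ℝ, 0 ≤ C ∧ ∀ (T : RectMesh Ω) (v : T.Space k), ∫ x in A, sqDensity v x ≤ C * energy Γ v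

theorem Controlled.mono {Γ A B : Set (Fin (n + 1) → ℝ)} (hA : Controlled Ω Γ k A) (hBA : B ⊆ A) :
    Controlled Ω Γ k B := by
  obtain ⟨C, hC, h⟩ := hA
  refine ⟨C, hC, fun T v => le_trans ?_ (h T v)⟩
  exact setIntegral_mono_set (integrable_sqDensity v).integrableOn
    (Filter.Eventually.of_forall fun x => sqDensity_nonneg v x) hBA.eventuallyLE

/-- Control of a slab passes to the whole box: apply the estimate on lines in direction `j`, all of
which stay in `Ω` inside the box, and integrate over their parameters. -/
theorem Controlled.widen {R : ℝ} (hΩ : IsOpen Ω) (hR : ∀ x ∈ closure Ω, ∀ i, |x i| ≤ R)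
    (hR0 : 0 ≤ R) {Γ : Set (Fin (n + 1) → ℝ)} (hΓ : MeasurableSet Γ) {l u : Fin (n + 1) → ℝ}
    (hsub : openBox l u ⊆ Ω) (j : Fin (n + 1)) {α β : ℝ} (hα : l j ≤ α) (hαβ : α < β) (hβ : β ≤ u j)
    (h : Controlled Ω Γ k (openBox (Function.update l j α) (Function.update u j β))) :
    Controlled Ω Γ k (openBox l u) := by
  obtain ⟨C, hC, h⟩ := h
  have hL : 0 < u j - l j := by linarith
  have hL' : 0 < β - α := by linarith
  refine ⟨(2 * (u j - l j) * C + 8 * R * (u j - l j) * (β - α)) / (β - α), by positivity,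
    fun T v => ?_⟩
  set U := openBox (j.removeNth l) (j.removeNth u) with hU
  have hfub := setIntegral_insertNth j (A := openBox l u) (fun t y => insertNth_mem_openBox)
    (integrable_sqDensity v).integrableOn
  have hfub' := setIntegral_insertNth j
    (A := openBox (Function.update l j α) (Function.update u j β))
    (fun t y => insertNth_mem_openBox) (integrable_sqDensity v).integrableOn
  simp only [Function.update_self, Fin.removeNth_update] at hfub'
  have hE := (energy_eq hΓ v).1 j
  have hmain : (β - α) * ∫ x in openBox l u, sqDensity v x
      ≤ 2 * (u j - l j) * (∫ x in openBox (Function.update l j α) (Function.update u j β),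
          sqDensity v x) + 8 * R * (u j - l j) * (β - α) * ∫ y in U, lineEnergy Γ v j y := by
    rw [hfub.2, hfub'.2, ← integral_const_mul, ← integral_const_mul, ← integral_const_mul,
      ← integral_add (hfub'.1.const_mul _) (hE.integrableOn.const_mul _)]
    refine setIntegral_mono_on_ae (hfub.1.const_mul _)
      ((hfub'.1.const_mul _).add (hE.integrableOn.const_mul _)) (measurableSet_openBox _ _) ?_
    filter_upwards [T.ae_generic j] with y hy hyU
    exact setIntegral_sqDensity_line_le hΩ hR hR0 Γ v hy hα hαβ hβ
      fun x hx => hsub (insertNth_mem_openBox.mpr ⟨hx, hyU⟩)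
  rw [div_mul_eq_mul_div, le_div_iff₀ hL', mul_comm, add_mul]
  refine hmain.trans (add_le_add ?_ ?_)
  · rw [mul_assoc (2 * (u j - l j))]
    exact mul_le_mul_of_nonneg_left (h T v) (by positivity)
  · exact mul_le_mul_of_nonneg_left (integral_lineEnergy_le hΓ v j U) (by positivity)

theorem Controlled.of_subbox {R : ℝ} (hΩ : IsOpen Ω) (hR : ∀ x ∈ closure Ω, ∀ i, |x i| ≤ R)
    (hR0 : 0 ≤ R) {Γ : Set (Fin (n + 1) → ℝ)} (hΓ : MeasurableSet Γ) {l u l' u' : Fin (n + 1) → ℝ}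
    (hsub : openBox l u ⊆ Ω) (hl : ∀ i, l i ≤ l' i) (hlu : ∀ i, l' i < u' i) (hu : ∀ i, u' i ≤ u i)
    (h : Controlled Ω Γ k (openBox l' u')) : Controlled Ω Γ k (openBox l u) := by
  suffices H : ∀ s : Finset (Fin (n + 1)),
      Controlled Ω Γ k (openBox (s.piecewise l l') (s.piecewise u u')) by
    simpa using H Finset.univ
  intro s
  induction s using Finset.induction_on with
  | empty => simpa using h
  | insert j s hj ih =>
    refine Controlled.widen hΩ hR hR0 hΓ (subset_trans ?_ hsub) j (α := l' j) (β := u' j) ?_ (hlu j)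
      ?_ ?_
    · refine Set.pi_mono fun i _ => Set.Ioo_subset_Ioo ?_ ?_
      · by_cases hi : i ∈ insert j s <;> simp [Finset.piecewise, hi, hl i]
      · by_cases hi : i ∈ insert j s <;> simp [Finset.piecewise, hi, hu i]
    · simpa using hl j
    · simpa using hu j
    -- Cutting the newly widened box back in direction `j` recovers the box of the induction
    -- hypothesis, because `j ∉ s`.
    · rw [Finset.piecewise_insert, Finset.piecewise_insert, Function.update_idem,
        Function.update_idem, Function.update_eq_self_iff.mpr, Function.update_eq_self_iff.mpr]
      · exact ih
      · simp [hj]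
      · simp [hj]

/-- The box `B` need not be a cell of `T`. Walk from `t` to the face of `B`: some cell of `T` ends
exactly there, and its Dirichlet term bounds the starting value. The constant is `2 * 2R` from this
term plus `2 * 4R` from the walk. -/
theorem sqDensity_line_le_of_dirichlet {R : ℝ} (hΩ : IsOpen Ω)
    (hR : ∀ x ∈ closure Ω, ∀ i, |x i| ≤ R) (hR0 : 0 ≤ R) {Γ : Set (Fin (n + 1) → ℝ)}
    (hΓ : Γ ⊆ frontier Ω) (v : T.Space k) {B : Box (Fin (n + 1))} (hB : Box.Ioo B ⊆ Ω)
    {j : Fin (n + 1)} {s : Bool} (hface : closedFace B j s ⊆ Γ) {y : Fin n → ℝ}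
    (hy : T.Generic j y) (hyB : y ∈ Box.Ioo (B.face j)) {t : ℝ}
    (ht : t ∈ Set.Ioo (B.lower j) (B.upper j)) (htf : T.OffFaces j t) :
    sqDensity v (j.insertNth t y) ≤ 12 * R * lineEnergy Γ v j y := by
  classical
  have hmem : ∀ x ∈ Set.Ioo (B.lower j) (B.upper j), (j.insertNth x y : Fin (n + 1) → ℝ) ∈ Ω :=
    fun x hx => hB (insertNth_mem_Ioo.mpr ⟨hx, hyB⟩)
  obtain ⟨K', hK', htK, htq⟩ := exists_cell_Ioo hy htf (hmem t ht) v
  have hx0 : facePoint B j s y ∈ Γ := hface ⟨y, Box.Ioo_subset_Icc _ hyB, rfl⟩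
  have hx0' := notMem_of_subset_frontier hΩ hΓ hx0
  set S : Finset (Fin T.numCells) := Finset.univ.filter (fun K => y ∈ Box.Ioo ((T.cell K).face j))
    with hS
  have hmS : ∀ K, K ∈ S ↔ y ∈ Box.Ioo ((T.cell K).face j) := fun K => by simp [hS]
  have hcov : ∀ x ∈ Set.Ioo (B.lower j) (B.upper j),
      ∃ K ∈ S, x ∈ Set.Icc ((T.cell K).lower j) ((T.cell K).upper j) := fun x hx => by
    obtain ⟨K, hK, hxK⟩ := exists_cell_Icc hy (hmem x hx)
    exact ⟨K, (hmS K).mpr hK, hxK⟩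
  have hE := lineEnergy_nonneg Γ v j y
  suffices H : ∃ K : Fin T.numCells, y ∈ T.faceIn Γ K j s ∧
      ((line v K' j y).eval t - (line v K j y).eval (faceCoord (T.cell K) j s)) ^ 2
        ≤ 4 * R * lineEnergy Γ v j y by
    obtain ⟨K, hyK, hdiff⟩ := H
    have hdir := sq_dirichlet_le_lineEnergy v hyK
    have hw : width (T.cell K) j ≤ 2 * R := by
      have := cell_bounds hR T K j
      simp only [width]
      linarith
    have := mul_le_mul_of_nonneg_right hw hE
    rw [htq]
    linarith [sq_le_two_mul_add hdiff]
  cases s with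
  | false =>
    -- No cell has the face point in its interior, since that point lies on the frontier of the open
    -- set `Ω`.
    obtain ⟨K, hK, hKa⟩ := exists_left_endpoint_eq (B.lower_lt_upper j) (fun K hK h => by
      by_contra! h'
      exact hx0' (T.Ioo_cell_subset K (insertNth_mem_Ioo.mpr ⟨⟨h, h'⟩, (hmS K).mp hK⟩))) hcov
    have hcoord : faceCoord (T.cell K) j false = B.lower j := hKa
    refine ⟨K, ⟨Box.Ioo_subset_Icc _ ((hmS K).mp hK), ?_⟩, ?_⟩
    · change (j.insertNth (faceCoord (T.cell K) j false) y : Fin (n + 1) → ℝ) ∈ Γ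
      rw [hcoord]
      exact hx0
    · rw [hcoord, sub_sq_comm]
      exact sq_line_sub_le hΩ hR hR0 Γ v hy ((hmS K).mp hK) hK'
        ⟨hKa.le, hKa ▸ ((T.cell K).lower_lt_upper j).le⟩ ⟨htK.1, htK.2.le⟩ ht.1
        fun x hx => hmem x ⟨hx.1, hx.2.trans ht.2⟩
  | true =>
    obtain ⟨K, hK, hKb⟩ := exists_right_endpoint_eq (B.lower_lt_upper j) (fun K hK h => by
      by_contra! h'
      exact hx0' (T.Ioo_cell_subset K (insertNth_mem_Ioo.mpr ⟨⟨h', h⟩, (hmS K).mp hK⟩))) hcov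
    have hcoord : faceCoord (T.cell K) j true = B.upper j := hKb
    refine ⟨K, ⟨Box.Ioo_subset_Icc _ ((hmS K).mp hK), ?_⟩, ?_⟩
    · change (j.insertNth (faceCoord (T.cell K) j true) y : Fin (n + 1) → ℝ) ∈ Γ
      rw [hcoord]
      exact hx0
    · rw [hcoord]
      exact sq_line_sub_le hΩ hR hR0 Γ v hy hK' ((hmS K).mp hK) ⟨htK.1.le, htK.2.le⟩
        ⟨hKb ▸ (T.cell K).lower_lt_upper j, hKb.ge⟩ ht.2
        fun x hx => hmem x ⟨ht.1.trans hx.1, hx.2⟩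

theorem controlled_of_dirichlet {R : ℝ} (hΩ : IsOpen Ω)
    (hR : ∀ x ∈ closure Ω, ∀ i, |x i| ≤ R) (hR0 : 0 ≤ R) {Γ : Set (Fin (n + 1) → ℝ)}
    (hΓm : MeasurableSet Γ) (hΓ : Γ ⊆ frontier Ω) {B : Box (Fin (n + 1))} (hB : Box.Ioo B ⊆ Ω)
    {j : Fin (n + 1)} {s : Bool} (hface : closedFace B j s ⊆ Γ) :
    Controlled Ω Γ k (Box.Ioo B) := by
  have hL : 0 < B.upper j - B.lower j := sub_pos.mpr (B.lower_lt_upper j)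
  refine ⟨(B.upper j - B.lower j) * (12 * R), by positivity, fun T v => ?_⟩
  have hfub := setIntegral_insertNth j (fun t y => insertNth_mem_Ioo (B := B))
    (integrable_sqDensity v).integrableOn
  have hE := (energy_eq hΓm v).1 j
  rw [hfub.2]
  calc _ ≤ ∫ y in Box.Ioo (B.face j), (B.upper j - B.lower j) * (12 * R) * lineEnergy Γ v j y := by
        refine setIntegral_mono_on_ae hfub.1 (hE.integrableOn.const_mul _)
          (isOpen_boxIoo _).measurableSet ?_
        filter_upwards [T.ae_generic j] with y hy hyB
        rw [mul_assoc]
        exact setIntegral_Ioo_le_of_forall (integrable_sqDensity_line v j y)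
          (B.lower_lt_upper j).le (T.ae_offFaces j) fun t ht htf =>
            sqDensity_line_le_of_dirichlet hΩ hR hR0 hΓ v hB hface hy hyB ht htf
    _ ≤ _ := by
        rw [integral_const_mul]
        exact mul_le_mul_of_nonneg_left (integral_lineEnergy_le hΓm v j _) (by positivity)

theorem ball_eq_openBox (x : Fin (n + 1) → ℝ) {r : ℝ} (hr : 0 < r) :
    Metric.ball x r = openBox (fun i => x i - r) (fun i => x i + r) := by
  rw [ball_pi _ hr]
  simp only [Real.ball_eq_Ioo]
  rfl

/-- The set of points with a controlled ball is open, meets `Ω` and is relatively closed in it, so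
it contains the connected set `Ω`. Balls of the sup metric are cubes, to which
`Controlled.of_subbox` applies. -/
theorem exists_ball_controlled {R : ℝ} (hΩ : IsOpen Ω) (hconn : IsConnected Ω)
    (hR : ∀ x ∈ closure Ω, ∀ i, |x i| ≤ R) (hR0 : 0 ≤ R) {Γ : Set (Fin (n + 1) → ℝ)}
    (hΓm : MeasurableSet Γ) {U₀ : Set (Fin (n + 1) → ℝ)} (hU₀ : IsOpen U₀) (hne : U₀.Nonempty)
    (hsub : U₀ ⊆ Ω) (hctrl : Controlled Ω Γ k U₀) {x : Fin (n + 1) → ℝ} (hx : x ∈ Ω) :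
    ∃ r > 0, Controlled Ω Γ k (Metric.ball x r) := by
  set U : Set (Fin (n + 1) → ℝ) := {x | ∃ r > 0, Controlled Ω Γ k (Metric.ball x r)} with hU
  have hopen : IsOpen U := by
    rw [Metric.isOpen_iff]
    rintro x ⟨r, hr, hc⟩
    refine ⟨r, hr, fun z hz => ?_⟩
    obtain ⟨ε, hε, hball⟩ := Metric.isOpen_iff.mp Metric.isOpen_ball z hz
    exact ⟨ε, hε, hc.mono hball⟩
  have hmeet : (Ω ∩ U).Nonempty := by
    obtain ⟨z, hz⟩ := hne
    obtain ⟨ε, hε, hball⟩ := Metric.isOpen_iff.mp hU₀ z hz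
    exact ⟨z, hsub hz, ε, hε, hctrl.mono hball⟩
  refine hconn.isPreconnected.subset_of_closure_inter_subset hopen hmeet ?_ hx
  rintro z ⟨hzU, hzΩ⟩
  obtain ⟨r, hr, hball⟩ := Metric.isOpen_iff.mp hΩ z hzΩ
  obtain ⟨q, hq, ρ, hρ, hc⟩ : ∃ q ∈ Metric.ball z r, q ∈ U := by
    obtain ⟨q, hqU, hq⟩ := Metric.mem_closure_iff.mp hzU r hr
    exact ⟨q, Metric.mem_ball'.mpr hq, hqU⟩
  -- Small enough for the cube around `q` to be controlled and to lie inside the cube of radius `r`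
  -- around `z`.
  set δ := min ρ (r - dist q z) with hδdef
  have hδ : 0 < δ := lt_min hρ (sub_pos.mpr hq)
  have hcδ := hc.mono (Metric.ball_subset_ball (min_le_left ρ (r - dist q z)))
  refine ⟨r, hr, ?_⟩
  have hdist : ∀ i, |q i - z i| + δ ≤ r := fun i => by
    have h1 : |q i - z i| ≤ dist q z := dist_le_pi_dist q z i
    linarith [min_le_right ρ (r - dist q z)]
  rw [← hδdef, ball_eq_openBox q hδ] at hcδ
  rw [ball_eq_openBox z hr] at hball ⊢
  refine hcδ.of_subbox hΩ hR hR0 hΓm hball (fun i => ?_) (fun i => by linarith) (fun i => ?_)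
  · linarith [hdist i, neg_abs_le (q i - z i)]
  · linarith [hdist i, le_abs_self (q i - z i)]

/-- A Poincaré–Friedrichs inequality, uniform in the mesh. -/
theorem exists_poincare (hΩ : IsOpen Ω) (hconn : IsConnected Ω) (hbdd : Bornology.IsBounded Ω)
    {Γ : Set (Fin (n + 1) → ℝ)} (hΓm : MeasurableSet Γ) (hΓ : Γ ⊆ frontier Ω) (hne : Γ.Nonempty)
    (T₀ : RectMesh Ω) (hT₀ : T₀.Resolves Γ) (k : ℕ) :
    ∃ C : ℝ, 0 ≤ C ∧ ∀ (T : RectMesh Ω) (v : T.Space k), l2norm v ^ 2 ≤ C * energy Γ v := by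
  obtain ⟨R, hR0, hR⟩ : ∃ R : ℝ, 0 ≤ R ∧ ∀ x ∈ closure Ω, ∀ i, |x i| ≤ R := by
    obtain ⟨R, hR⟩ := hbdd.closure.exists_norm_le
    refine ⟨max R 0, le_max_right _ _, fun x hx i => ?_⟩
    exact ((norm_le_pi_norm x i).trans (hR x hx)).trans (le_max_left _ _)
  obtain ⟨x₀, hx₀⟩ := hne
  -- The reference mesh `T₀` supplies a box with a Dirichlet face and a finite cover of `Ω` by
  -- boxes; the estimates themselves hold for every mesh `T`.
  obtain ⟨K₀, j, s, -, hface⟩ := hT₀ x₀ hx₀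
  have hc₀ : Controlled Ω Γ k (Box.Ioo (T₀.cell K₀)) :=
    controlled_of_dirichlet hΩ hR hR0 hΓm hΓ (T₀.Ioo_cell_subset K₀) hface
  have hcenter : ∀ B : Box (Fin (n + 1)), (fun i => (B.lower i + B.upper i) / 2) ∈ Box.Ioo B := by
    intro B
    rw [mem_Ioo_iff]
    intro i
    have := B.lower_lt_upper i
    exact ⟨by linarith, by linarith⟩
  have hcell : ∀ K, Controlled Ω Γ k (Box.Ioo (T₀.cell K)) := by
    intro K
    set B := T₀.cell K
    set c : Fin (n + 1) → ℝ := fun i => (B.lower i + B.upper i) / 2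
    obtain ⟨r, hr, hcr⟩ := exists_ball_controlled hΩ hconn hR hR0 hΓm (isOpen_boxIoo _)
      ⟨_, hcenter _⟩ (T₀.Ioo_cell_subset K₀) hc₀ (T₀.Ioo_cell_subset K (hcenter B))
    rw [ball_eq_openBox _ hr] at hcr
    -- The controlled cube around the centre may leave the cell, so its intersection with the cell
    -- is the starting subbox.
    refine (hcr.mono (B := openBox (fun i => max (B.lower i) (c i - r))
      (fun i => min (B.upper i) (c i + r))) ?_).of_subbox hΩ hR hR0 hΓm (T₀.Ioo_cell_subset K)
      (fun i => le_max_left _ _) (fun i => ?_) (fun i => min_le_left _ _)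
    · exact Set.pi_mono fun i _ => Set.Ioo_subset_Ioo (le_max_right _ _) (min_le_right _ _)
    · have := (mem_Ioo_iff.mp (hcenter B)) i
      exact max_lt (lt_min (B.lower_lt_upper i) (this.1.trans (lt_add_of_pos_right _ hr)))
        (lt_min ((sub_lt_self _ hr).trans this.2) (by linarith))
  choose C hC0 hC using hcell
  refine ⟨∑ K, C K, Finset.sum_nonneg fun K _ => hC0 K, fun T v => ?_⟩
  have hint := integrable_sqDensity v
  have hnorm : l2norm v ^ 2 = ∫ x, sqDensity v x := by
    rw [l2norm, Real.sq_sqrt, integral_sqDensity]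
    exact Finset.sum_nonneg fun K _ => setIntegral_nonneg (measurableSet_boxIcc _)
      fun x _ => sq_nonneg _
  rw [hnorm, Finset.sum_mul]
  calc ∫ x, sqDensity v x ≤ ∫ x, ∑ K, (Box.Icc (T₀.cell K)).indicator (sqDensity v) x := by
        refine integral_mono hint (integrable_finsetSum _ fun K _ =>
          hint.indicator (measurableSet_boxIcc _)) fun x => ?_
        have hnn : ∀ K, 0 ≤ (Box.Icc (T₀.cell K)).indicator (sqDensity v) x := fun K =>
          Set.indicator_nonneg (fun x _ => sqDensity_nonneg v x) x
        by_cases hx : x ∈ Ω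
        · obtain ⟨K, hK⟩ := Set.mem_iUnion.mp (T₀.subset_iUnion_Icc_cell hx)
          refine le_trans (le_of_eq (Set.indicator_of_mem hK _).symm)
            (Finset.single_le_sum (fun K _ => hnn K) (Finset.mem_univ K))
        · dsimp only
          rw [sqDensity_eq_zero v hx]
          exact Finset.sum_nonneg fun K _ => hnn K
    _ = ∑ K, ∫ x in Box.Ioo (T₀.cell K), sqDensity v x := by
        rw [integral_finsetSum _ fun K _ => hint.indicator (measurableSet_boxIcc _)]
        refine Finset.sum_congr rfl fun K _ => ?_
        rw [integral_indicator (measurableSet_boxIcc _)]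
        exact (setIntegral_congr_set (Box.Ioo_ae_eq_Icc _)).symm
    _ ≤ _ := Finset.sum_le_sum fun K _ => hC K T v

end RectMesh
end DDG

end

noncomputable section
namespace DDG

open BoxIntegral

namespace RectMesh

variable {n : ℕ} {Ω : Set (Fin (n + 1) → ℝ)} {T : RectMesh Ω} {k : ℕ}

/-! ### Linearity of the forms -/

theorem val_smul_add (a : ℝ) (v w : T.Space k) (K : Fin T.numCells) (x : Fin (n + 1) → ℝ) :
    val (a • v + w) K x = a * val v K x + val w K x := by
  simp [val, MvPolynomial.smul_eval]

theorem d1_smul_add (a : ℝ) (v w : T.Space k) (K : Fin T.numCells) (j : Fin (n + 1))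
    (x : Fin (n + 1) → ℝ) : d1 (a • v + w) K j x = a * d1 v K j x + d1 w K j x := by
  simp [d1, MvPolynomial.smul_eval]

theorem d2_smul_add (a : ℝ) (v w : T.Space k) (K : Fin T.numCells) (j : Fin (n + 1))
    (x : Fin (n + 1) → ℝ) : d2 (a • v + w) K j x = a * d2 v K j x + d2 w K j x := by
  simp [d2, MvPolynomial.smul_eval]

theorem jump_smul_add (a : ℝ) (v w : T.Space k) (K₁ K₂ : Fin T.numCells) (x : Fin (n + 1) → ℝ) :
    jump (a • v + w) K₁ K₂ x = a * jump v K₁ K₂ x + jump w K₁ K₂ x := by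
  simp only [jump, val_smul_add]
  ring

theorem avgD1_smul_add (a : ℝ) (v w : T.Space k) (K₁ K₂ : Fin T.numCells) (j : Fin (n + 1))
    (x : Fin (n + 1) → ℝ) :
    avgD1 (a • v + w) K₁ K₂ j x = a * avgD1 v K₁ K₂ j x + avgD1 w K₁ K₂ j x := by
  simp only [avgD1, d1_smul_add]
  ring

theorem flux_smul_add (β₀ β₁ a : ℝ) (v w : T.Space k) (K₁ K₂ : Fin T.numCells) (j : Fin (n + 1))
    (x : Fin (n + 1) → ℝ) :
    flux β₀ β₁ (a • v + w) K₁ K₂ j x = a * flux β₀ β₁ v K₁ K₂ j x + flux β₀ β₁ w K₁ K₂ j x := by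
  simp only [flux, jumpD2, jump_smul_add, avgD1_smul_add, d2_smul_add]
  ring

theorem setIntegral_mul_add {m : ℕ} {A : Set (Fin m → ℝ)} {f g : (Fin m → ℝ) → ℝ} (a : ℝ)
    (hf : IntegrableOn f A) (hg : IntegrableOn g A) :
    ∫ x in A, (a * f x + g x) = a * (∫ x in A, f x) + ∫ x in A, g x := by
  rw [MeasureTheory.integral_add (hf.const_mul a) hg, MeasureTheory.integral_const_mul]

theorem boundaryIntegral_mul_add {Γ : Set (Fin (n + 1) → ℝ)} (a : ℝ)
    {f g : Fin T.numCells → Fin (n + 1) → Bool → (Fin (n + 1) → ℝ) → ℝ}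
    (hf : ∀ K j s, IntegrableOn (fun y => f K j s (facePoint (T.cell K) j s y)) (T.faceIn Γ K j s))
    (hg : ∀ K j s, IntegrableOn (fun y => g K j s (facePoint (T.cell K) j s y)) (T.faceIn Γ K j s)) :
    T.boundaryIntegral Γ (fun K j s x => a * f K j s x + g K j s x)
      = a * T.boundaryIntegral Γ f + T.boundaryIntegral Γ g := by
  simp only [boundaryIntegral, setIntegral_mul_add a (hf _ _ _) (hg _ _ _), Finset.sum_add_distrib,
    Finset.mul_sum]

theorem interfaceIntegral_mul_add (a : ℝ)
    {f g : Fin T.numCells → Fin T.numCells → Fin (n + 1) → (Fin (n + 1) → ℝ) → ℝ}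
    (hf : ∀ K₁ K₂ j, Continuous (f K₁ K₂ j)) (hg : ∀ K₁ K₂ j, Continuous (g K₁ K₂ j)) :
    T.interfaceIntegral (fun K₁ K₂ j x => a * f K₁ K₂ j x + g K₁ K₂ j x)
      = a * T.interfaceIntegral f + T.interfaceIntegral g := by
  have hint : ∀ (f : Fin T.numCells → Fin T.numCells → Fin (n + 1) → (Fin (n + 1) → ℝ) → ℝ),
      (∀ K₁ K₂ j, Continuous (f K₁ K₂ j)) → ∀ K₁ K₂ j,
      IntegrableOn (fun y => f K₁ K₂ j (facePoint (T.cell K₁) j true y))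
        (Box.Icc ((T.cell K₁).face j) ∩ Box.Icc ((T.cell K₂).face j)) := fun f hf K₁ K₂ j =>
    (((hf K₁ K₂ j).comp (continuous_facePoint _ _ _)).continuousOn.integrableOn_compact
      (Box.isCompact_Icc _)).mono_set Set.inter_subset_left
  simp only [interfaceIntegral, Finset.mul_sum, ← Finset.sum_add_distrib]
  refine Finset.sum_congr rfl fun j _ => Finset.sum_congr rfl fun K₁ _ =>
    Finset.sum_congr rfl fun K₂ _ => ?_
  split_ifs
  · exact setIntegral_mul_add a (hint f hf K₁ K₂ j) (hint g hg K₁ K₂ j)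
  · simp

theorem integrableOn_faceIn {Γ : Set (Fin (n + 1) → ℝ)} {f : (Fin (n + 1) → ℝ) → ℝ}
    (hf : Continuous f) (K : Fin T.numCells) (j : Fin (n + 1)) (s : Bool) :
    IntegrableOn (fun y => f (facePoint (T.cell K) j s y)) (T.faceIn Γ K j s) :=
  ((hf.comp (continuous_facePoint _ _ _)).continuousOn.integrableOn_compact
    (Box.isCompact_Icc _)).mono_set Set.inter_subset_left

theorem meshSum_mul_add {Γ : Set (Fin (n + 1) → ℝ)} (a : ℝ)
    {f f' : Fin T.numCells → Fin (n + 1) → (Fin (n + 1) → ℝ) → ℝ}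
    {g g' : Fin T.numCells → Fin T.numCells → Fin (n + 1) → (Fin (n + 1) → ℝ) → ℝ}
    {h h' : Fin T.numCells → Fin (n + 1) → Bool → (Fin (n + 1) → ℝ) → ℝ}
    (hf : ∀ K j, Continuous (f K j)) (hf' : ∀ K j, Continuous (f' K j))
    (hg : ∀ K₁ K₂ j, Continuous (g K₁ K₂ j)) (hg' : ∀ K₁ K₂ j, Continuous (g' K₁ K₂ j))
    (hh : ∀ K j s, Continuous (h K j s)) (hh' : ∀ K j s, Continuous (h' K j s)) :
    T.meshSum Γ (fun K j x => a * f K j x + f' K j x)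
        (fun K₁ K₂ j x => a * g K₁ K₂ j x + g' K₁ K₂ j x)
        (fun K j s x => a * h K j s x + h' K j s x)
      = a * T.meshSum Γ f g h + T.meshSum Γ f' g' h' := by
  have hcell : ∀ K, ∫ x in Box.Icc (T.cell K), ∑ j, (a * f K j x + f' K j x)
      = a * (∫ x in Box.Icc (T.cell K), ∑ j, f K j x) + ∫ x in Box.Icc (T.cell K), ∑ j, f' K j x := by
    intro K
    have hc : ∀ (f : Fin T.numCells → Fin (n + 1) → (Fin (n + 1) → ℝ) → ℝ),
        (∀ K j, Continuous (f K j)) → IntegrableOn (fun x => ∑ j, f K j x) (Box.Icc (T.cell K)) :=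
      fun f hf => (continuous_finsetSum _ fun j _ => hf K j).continuousOn.integrableOn_compact
        (Box.isCompact_Icc _)
    rw [← setIntegral_mul_add a (hc f hf) (hc f' hf')]
    simp only [Finset.sum_add_distrib, Finset.mul_sum]
  simp only [meshSum, hcell]
  rw [interfaceIntegral_mul_add a hg hg',
    boundaryIntegral_mul_add a (fun K j s => integrableOn_faceIn (hh K j s) K j s)
      (fun K j s => integrableOn_faceIn (hh' K j s) K j s), Finset.sum_add_distrib, ← Finset.mul_sum]
  ring

theorem formA_eq_meshSum (Γ : Set (Fin (n + 1) → ℝ)) (β₀ β₁ : ℝ) (ψ η : T.Space k) :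
    formA Γ β₀ β₁ ψ η = T.meshSum Γ (fun K j x => d1 ψ K j x * d1 η K j x)
      (fun K₁ K₂ j x =>
        flux β₀ β₁ ψ K₁ K₂ j x * jump η K₁ K₂ x + avgD1 η K₁ K₂ j x * jump ψ K₁ K₂ x)
      (fun K j s x => (β₀ / width (T.cell K) j * val ψ K x - normalSign s * d1 ψ K j x) * val η K x
        - val ψ K x * (normalSign s * d1 η K j x)) := rfl

theorem formA_smul_add_left (Γ : Set (Fin (n + 1) → ℝ)) (β₀ β₁ a : ℝ) (ψ ψ' η : T.Space k) :
    formA Γ β₀ β₁ (a • ψ + ψ') η = a * formA Γ β₀ β₁ ψ η + formA Γ β₀ β₁ ψ' η := by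
  simp only [formA_eq_meshSum]
  rw [← meshSum_mul_add]
  · simp only [d1_smul_add, val_smul_add, jump_smul_add, flux_smul_add]
    congr 1 <;> (ext; ring)
  all_goals (intros; fun_prop)

theorem formA_smul_add_right (Γ : Set (Fin (n + 1) → ℝ)) (β₀ β₁ a : ℝ) (ψ η η' : T.Space k) :
    formA Γ β₀ β₁ ψ (a • η + η') = a * formA Γ β₀ β₁ ψ η + formA Γ β₀ β₁ ψ η' := by
  simp only [formA_eq_meshSum]
  rw [← meshSum_mul_add]
  · simp only [d1_smul_add, val_smul_add, jump_smul_add, avgD1_smul_add]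
    congr 1 <;> (ext; ring)
  all_goals (intros; fun_prop)

/-- A linear functional from a function that preserves the combinations `a • x + y`. -/
def linearOfSmulAdd {V : Type*} [AddCommGroup V] [Module ℝ V] (F : V → ℝ)
    (hF : ∀ (a : ℝ) x y, F (a • x + y) = a * F x + F y) : V →ₗ[ℝ] ℝ where
  toFun := F
  map_add' x y := by simpa using hF 1 x y
  map_smul' a x := by
    have h0 : F 0 = 0 := by simpa using hF 1 0 0
    simpa [h0] using hF a x 0

/-- The bilinear form `A` as a bundled bilinear map. -/
def formALin (T : RectMesh Ω) (k : ℕ) (Γ : Set (Fin (n + 1) → ℝ)) (β₀ β₁ : ℝ) :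
    T.Space k →ₗ[ℝ] T.Space k →ₗ[ℝ] ℝ :=
  LinearMap.mk₂ ℝ (formA Γ β₀ β₁)
    (fun ψ ψ' η => (linearOfSmulAdd (fun ψ => formA Γ β₀ β₁ ψ η)
      fun a ψ ψ' => formA_smul_add_left Γ β₀ β₁ a ψ ψ' η).map_add ψ ψ')
    (fun a ψ η => (linearOfSmulAdd (fun ψ => formA Γ β₀ β₁ ψ η)
      fun a ψ ψ' => formA_smul_add_left Γ β₀ β₁ a ψ ψ' η).map_smul a ψ)
    (fun ψ η η' => (linearOfSmulAdd (formA Γ β₀ β₁ ψ)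
      fun a η η' => formA_smul_add_right Γ β₀ β₁ a ψ η η').map_add η η')
    (fun a ψ η => (linearOfSmulAdd (formA Γ β₀ β₁ ψ)
      fun a η η' => formA_smul_add_right Γ β₀ β₁ a ψ η η').map_smul a η)

/-- Closed cells may leave `Ω`, but they differ from the open cells inside `Ω` only by null sets. -/
theorem integrableOn_source {m : ℕ} (q : Fin m → ℝ) {ρ₀ : (Fin (n + 1) → ℝ) → ℝ}
    (hρ : IntegrableOn ρ₀ Ω) (c : Fin m → T.Space k) (η : T.Space k) (K : Fin T.numCells) :
    IntegrableOn (fun x => ((∑ i, q i * val (c i) K x) + ρ₀ x) * val η K x)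
      (Box.Icc (T.cell K)) := by
  have hρK : IntegrableOn ρ₀ (Box.Icc (T.cell K)) :=
    (hρ.mono_set (T.Ioo_cell_subset K)).congr_set_ae (Box.Ioo_ae_eq_Icc _).symm
  have hsum : Continuous fun x => ∑ i, q i * val (c i) K x :=
    continuous_finsetSum _ fun i _ => continuous_const.mul (continuous_val (c i) K)
  exact ((hsum.continuousOn.integrableOn_compact (Box.isCompact_Icc _)).add hρK).mul_continuousOn
    (continuous_val η K).continuousOn (Box.isCompact_Icc _)

theorem integrableOn_boundary {Γ : Set (Fin (n + 1) → ℝ)} (hΓ : MeasurableSet Γ)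
    {g : (Fin (n + 1) → ℝ) → ℝ} (hg : T.BoundaryIntegrable Γ g) {f : (Fin (n + 1) → ℝ) → ℝ}
    (hf : Continuous f) (K : Fin T.numCells) (j : Fin (n + 1)) (s : Bool) :
    IntegrableOn (fun y => f (facePoint (T.cell K) j s y) * g (facePoint (T.cell K) j s y))
      (T.faceIn Γ K j s) :=
  (hg K j s).continuousOn_mul_of_subset (hf.comp (continuous_facePoint _ j s)).continuousOn
    (Box.isCompact_Icc _) (T.measurableSet_faceIn hΓ K j s) Set.inter_subset_left

theorem formL_smul_add {Γ : Set (Fin (n + 1) → ℝ)} (hΓ : MeasurableSet Γ) (β₀ : ℝ) {m : ℕ}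
    (q : Fin m → ℝ) {ρ₀ ψD σ : (Fin (n + 1) → ℝ) → ℝ} (hρ : IntegrableOn ρ₀ Ω)
    (hψ : T.BoundaryIntegrable Γ ψD) (hσ : T.BoundaryIntegrable (frontier Ω \ Γ) σ)
    (c : Fin m → T.Space k) (a : ℝ) (η η' : T.Space k) :
    formL Γ β₀ q ρ₀ ψD σ c (a • η + η')
      = a * formL Γ β₀ q ρ₀ ψD σ c η + formL Γ β₀ q ρ₀ ψD σ c η' := by
  have hN : MeasurableSet (frontier Ω \ Γ) := isClosed_frontier.measurableSet.diff hΓ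
  have h1 : ∀ K, ∫ x in Box.Icc (T.cell K),
      ((∑ i, q i * val (c i) K x) + ρ₀ x) * val (a • η + η') K x
      = a * (∫ x in Box.Icc (T.cell K), ((∑ i, q i * val (c i) K x) + ρ₀ x) * val η K x)
        + ∫ x in Box.Icc (T.cell K), ((∑ i, q i * val (c i) K x) + ρ₀ x) * val η' K x := by
    intro K
    rw [← setIntegral_mul_add a (integrableOn_source q hρ c η K) (integrableOn_source q hρ c η' K)]
    congr 1
    ext x
    rw [val_smul_add]
    ring
  have h2 := boundaryIntegral_mul_add (T := T) (Γ := Γ) a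
    (f := fun K j s x => (β₀ / width (T.cell K) j * val η K x - normalSign s * d1 η K j x) * ψD x)
    (g := fun K j s x => (β₀ / width (T.cell K) j * val η' K x - normalSign s * d1 η' K j x) * ψD x)
    (fun K j s => integrableOn_boundary hΓ hψ
      (f := fun x => β₀ / width (T.cell K) j * val η K x - normalSign s * d1 η K j x)
      (by fun_prop) K j s)
    (fun K j s => integrableOn_boundary hΓ hψ
      (f := fun x => β₀ / width (T.cell K) j * val η' K x - normalSign s * d1 η' K j x)
      (by fun_prop) K j s)
  have h3 := boundaryIntegral_mul_add (T := T) (Γ := frontier Ω \ Γ) a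
    (f := fun K _ _ x => val η K x * σ x) (g := fun K _ _ x => val η' K x * σ x)
    (fun K j s => integrableOn_boundary hN hσ (continuous_val η K) K j s)
    (fun K j s => integrableOn_boundary hN hσ (continuous_val η' K) K j s)
  have e2 : (fun (K : Fin T.numCells) (j : Fin (n + 1)) (s : Bool) (x : Fin (n + 1) → ℝ) =>
      (β₀ / width (T.cell K) j * val (a • η + η') K x - normalSign s * d1 (a • η + η') K j x) * ψD x)
      = fun K j s x =>
        a * ((β₀ / width (T.cell K) j * val η K x - normalSign s * d1 η K j x) * ψD x)
        + (β₀ / width (T.cell K) j * val η' K x - normalSign s * d1 η' K j x) * ψD x := by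
    funext K j s x
    rw [val_smul_add, d1_smul_add]
    ring
  have e3 : (fun (K : Fin T.numCells) (_ : Fin (n + 1)) (_ : Bool) (x : Fin (n + 1) → ℝ) =>
      val (a • η + η') K x * σ x) = fun K _ _ x => a * (val η K x * σ x) + val η' K x * σ x := by
    funext K j s x
    rw [val_smul_add]
    ring
  simp only [formL, h1, mul_comm (σ _)]
  rw [e2, e3, h2, h3, Finset.sum_add_distrib, ← Finset.mul_sum]
  ring

/-! ### The `L²` inner product -/

/-- The `L²(Ω)` inner product on `V_h`. -/
def l2inner (u v : T.Space k) : ℝ := ∑ K, ∫ x in Box.Icc (T.cell K), val u K x * val v K x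

theorem l2norm_nonneg (v : T.Space k) : 0 ≤ l2norm v := Real.sqrt_nonneg _

theorem sq_l2norm (v : T.Space k) :
    l2norm v ^ 2 = ∑ K, ∫ x in Box.Icc (T.cell K), val v K x ^ 2 :=
  Real.sq_sqrt (Finset.sum_nonneg fun _ _ => setIntegral_nonneg (measurableSet_boxIcc _)
    fun _ _ => sq_nonneg _)

theorem integrableOn_cell {f : (Fin (n + 1) → ℝ) → ℝ} (hf : Continuous f) (K : Fin T.numCells) :
    IntegrableOn f (Box.Icc (T.cell K)) :=
  hf.continuousOn.integrableOn_compact (Box.isCompact_Icc _)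

theorem abs_l2inner_le (u v : T.Space k) : |l2inner u v| ≤ l2norm u * l2norm v := by
  -- Cauchy–Schwarz through the discriminant of the squared norm of `t • u + v`.
  have hquad : ∀ t : ℝ, 0 ≤ l2norm u ^ 2 * (t * t) + 2 * l2inner u v * t + l2norm v ^ 2 := by
    intro t
    have hexp : l2norm (t • u + v) ^ 2
        = l2norm u ^ 2 * (t * t) + 2 * l2inner u v * t + l2norm v ^ 2 := by
      simp only [sq_l2norm, l2inner, Finset.mul_sum, Finset.sum_mul, ← Finset.sum_add_distrib]
      refine Finset.sum_congr rfl fun K _ => ?_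
      have h1 : ∀ x, val (t • u + v) K x ^ 2
          = t * (t * val u K x ^ 2 + 2 * (val u K x * val v K x)) + val v K x ^ 2 := fun x => by
        rw [val_smul_add]; ring
      simp only [h1]
      rw [setIntegral_mul_add t (integrableOn_cell (by fun_prop) K) (integrableOn_cell (by fun_prop) K),
        setIntegral_mul_add t (integrableOn_cell (by fun_prop) K) (integrableOn_cell (by fun_prop) K),
        MeasureTheory.integral_const_mul]
      ring
    rw [← hexp]
    positivity
  have hd := discrim_le_zero hquad
  rw [discrim] at hd
  refine abs_le_of_sq_le_sq ?_ (mul_nonneg (l2norm_nonneg u) (l2norm_nonneg v))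
  nlinarith

/-- On each cell the polynomial vanishes almost everywhere, by continuity on the open cell, and
hence identically, as a polynomial vanishing on a product of infinite sets. -/
theorem eq_zero_of_l2norm_eq_zero {v : T.Space k} (h : l2norm v = 0) : v = 0 := by
  have hsum := sq_l2norm v
  rw [h, zero_pow two_ne_zero] at hsum
  have hK := (Finset.sum_eq_zero_iff_of_nonneg fun K _ => setIntegral_nonneg
    (measurableSet_boxIcc (T.cell K)) fun x _ => sq_nonneg (val v K x)).mp hsum.symm
  funext K
  have hz := hK K (Finset.mem_univ K)
  rw [setIntegral_eq_zero_iff_of_nonneg_ae (Filter.Eventually.of_forall fun x => sq_nonneg _)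
    (integrableOn_val_sq v K)] at hz
  have hzero : Set.EqOn (fun x => val v K x ^ 2) 0 (Box.Ioo (T.cell K)) :=
    Measure.eqOn_open_of_ae_eq (ae_restrict_of_ae_restrict_of_subset (Box.Ioo_subset_Icc _) hz)
      (isOpen_boxIoo _) ((continuous_val v K).pow 2).continuousOn continuousOn_const
  refine Subtype.ext (MvPolynomial.funext_set
    (fun i => Set.Ioo ((T.cell K).lower i) ((T.cell K).upper i))
    (fun i => Set.Ioo_infinite ((T.cell K).lower_lt_upper i)) (fun x hx => ?_))
  have := hzero (show x ∈ Box.Ioo (T.cell K) from hx)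
  simpa [val] using this

theorem formL_sub {Γ : Set (Fin (n + 1) → ℝ)} (β₀ : ℝ) {m : ℕ}
    (q : Fin m → ℝ) {ρ₀ ψD σ : (Fin (n + 1) → ℝ) → ℝ} (hρ : IntegrableOn ρ₀ Ω)
    (c c' : Fin m → T.Space k) (η : T.Space k) :
    formL Γ β₀ q ρ₀ ψD σ c η - formL Γ β₀ q ρ₀ ψD σ c' η = ∑ i, q i * l2inner (c i - c' i) η := by
  simp only [formL, l2inner, Finset.mul_sum]
  rw [Finset.sum_comm, add_sub_add_right_eq_sub, add_sub_add_right_eq_sub, ← Finset.sum_sub_distrib]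
  refine Finset.sum_congr rfl fun K _ => ?_
  rw [← MeasureTheory.integral_sub (integrableOn_source q hρ c η K)
    (integrableOn_source q hρ c' η K)]
  simp only [← MeasureTheory.integral_const_mul]
  rw [← integral_finsetSum _ fun i _ => integrableOn_cell (by fun_prop) K]
  congr 1
  ext x
  have hv : ∀ i, val (c i - c' i) K x = val (c i) K x - val (c' i) K x := fun i => by simp [val]
  simp only [hv]
  rw [← sub_mul, add_sub_add_right_eq_sub, ← Finset.sum_sub_distrib, Finset.sum_mul]
  exact Finset.sum_congr rfl fun i _ => by ring

theorem formL_sub_le {Γ : Set (Fin (n + 1) → ℝ)} (β₀ : ℝ) {m : ℕ}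
    (q : Fin m → ℝ) {ρ₀ ψD σ : (Fin (n + 1) → ℝ) → ℝ} (hρ : IntegrableOn ρ₀ Ω)
    (c c' : Fin m → T.Space k) (η : T.Space k) :
    formL Γ β₀ q ρ₀ ψD σ c η - formL Γ β₀ q ρ₀ ψD σ c' η
      ≤ (∑ i, |q i| * l2norm (c i - c' i)) * l2norm η := by
  rw [formL_sub β₀ q hρ, Finset.sum_mul]
  refine Finset.sum_le_sum fun i _ => ?_
  calc q i * l2inner (c i - c' i) η ≤ |q i * l2inner (c i - c' i) η| := le_abs_self _
    _ = |q i| * |l2inner (c i - c' i) η| := abs_mul _ _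
    _ ≤ |q i| * (l2norm (c i - c' i) * l2norm η) := by
        gcongr
        exact abs_l2inner_le _ _
    _ = _ := by ring

/-! ### Existence, uniqueness and stability -/

theorem Resolves.measurableSet {Γ : Set (Fin (n + 1) → ℝ)} (h : T.Resolves Γ) :
    MeasurableSet Γ := by
  have hΓ : Γ = ⋃ (K) (j) (s) (_ : closedFace (T.cell K) j s ⊆ Γ), closedFace (T.cell K) j s := by
    ext x
    simp only [Set.mem_iUnion]
    constructor
    · intro hx
      obtain ⟨K, j, s, hxF, hF⟩ := h x hx
      exact ⟨K, j, s, hF, hxF⟩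
    · rintro ⟨K, j, s, hF, hxF⟩
      exact hF hxF
  rw [hΓ]
  refine MeasurableSet.iUnion fun K => MeasurableSet.iUnion fun j => MeasurableSet.iUnion fun s =>
    MeasurableSet.iUnion fun _ => ?_
  exact ((Box.isCompact_Icc _).image (continuous_facePoint _ j s)).isClosed.measurableSet

theorem finite_restrictTotalDegree (σ : Type*) [Finite σ] (k : ℕ) :
    Module.Finite ℝ (MvPolynomial.restrictTotalDegree σ ℝ k) := by
  have hfin : {m : σ →₀ ℕ | (m.sum fun _ e => e) ≤ k}.Finite := by
    exact Finsupp.finite_of_degree_le k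
  have := hfin.to_subtype
  exact Module.Finite.of_basis (MvPolynomial.basisRestrictSupport ℝ _)

/-- Definiteness makes the map from `V_h` to its dual injective, and by equality of finite
dimensions bijective. -/
theorem existsUnique_isSolution {Γ : Set (Fin (n + 1) → ℝ)} (hΓ : MeasurableSet Γ) {β₀ β₁ : ℝ}
    (hinj : ∀ v : T.Space k, formA Γ β₀ β₁ v v = 0 → v = 0) {m : ℕ}
    (q : Fin m → ℝ) {ρ₀ ψD σ : (Fin (n + 1) → ℝ) → ℝ} (hρ : IntegrableOn ρ₀ Ω)
    (hψ : T.BoundaryIntegrable Γ ψD) (hσ : T.BoundaryIntegrable (frontier Ω \ Γ) σ)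
    (c : Fin m → T.Space k) : ∃! ψ : T.Space k, IsSolution Γ β₀ β₁ q ρ₀ ψD σ c ψ := by
  have := finite_restrictTotalDegree (Fin (n + 1)) k
  have hker : Function.Injective (formALin T k Γ β₀ β₁) := by
    rw [injective_iff_map_eq_zero]
    intro v hv
    exact hinj v (LinearMap.congr_fun hv v)
  have hsurj : Function.Surjective (formALin T k Γ β₀ β₁) :=
    (LinearMap.injective_iff_surjective_of_finrank_eq_finrank
      (Subspace.dual_finrank_eq (K := ℝ) (V := T.Space k)).symm).mp hker
  obtain ⟨ψ, hψsol⟩ := hsurj (linearOfSmulAdd (formL Γ β₀ q ρ₀ ψD σ c)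
    fun a η η' => formL_smul_add hΓ β₀ q hρ hψ hσ c a η η')
  refine ⟨ψ, fun η => LinearMap.congr_fun hψsol η, fun ψ' hψ' => hker ?_⟩
  rw [hψsol]
  exact LinearMap.ext hψ'

/-- Test the difference of the two equations with `e = ψ - ψ'`. The common data cancel, the right
side is at most `N ‖e‖`, and coercivity with the Poincaré inequality bounds `‖e‖²` by `C / γ` times
this. -/
theorem isSolution_stable {Γ : Set (Fin (n + 1) → ℝ)} {β₀ β₁ γ C : ℝ} (hγ : 0 < γ) (hC : 0 ≤ C)
    (hcoer : ∀ v : T.Space k, γ * energy Γ v ≤ formA Γ β₀ β₁ v v)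
    (hpoin : ∀ v : T.Space k, l2norm v ^ 2 ≤ C * energy Γ v) {m : ℕ} (q : Fin m → ℝ)
    {ρ₀ ψD σ : (Fin (n + 1) → ℝ) → ℝ} (hρ : IntegrableOn ρ₀ Ω) {c c' : Fin m → T.Space k}
    {ψ ψ' : T.Space k} (hψ : IsSolution Γ β₀ β₁ q ρ₀ ψD σ c ψ)
    (hψ' : IsSolution Γ β₀ β₁ q ρ₀ ψD σ c' ψ') :
    l2norm (ψ - ψ') ≤ C / γ * ∑ i, |q i| * l2norm (c i - c' i) := by
  set e := ψ - ψ' with he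
  set N := ∑ i, |q i| * l2norm (c i - c' i)
  have hN : 0 ≤ N := Finset.sum_nonneg fun i _ => mul_nonneg (abs_nonneg _) (l2norm_nonneg _)
  have hA : formA Γ β₀ β₁ e e ≤ N * l2norm e := by
    have hsub : formA Γ β₀ β₁ e e = formA Γ β₀ β₁ ψ e - formA Γ β₀ β₁ ψ' e := by
      have := formA_smul_add_left Γ β₀ β₁ (-1) ψ' ψ e
      rw [show (-1 : ℝ) • ψ' + ψ = e by rw [he]; module] at this
      linarith
    rw [hsub, hψ e, hψ' e]
    exact formL_sub_le β₀ q hρ c c' e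
  have hsq : l2norm e ^ 2 ≤ C / γ * N * l2norm e := by
    calc l2norm e ^ 2 ≤ C * energy Γ e := hpoin e
      _ = C / γ * (γ * energy Γ e) := by field_simp
      _ ≤ C / γ * (N * l2norm e) := by
          exact mul_le_mul_of_nonneg_left ((hcoer e).trans hA) (div_nonneg hC hγ.le)
      _ = _ := by ring
  rcases (l2norm_nonneg e).eq_or_lt with h0 | h0
  · rw [← h0]
    exact mul_nonneg (div_nonneg hC hγ.le) hN
  · refine le_of_mul_le_mul_right ?_ h0
    rwa [← sq]

/-! ### The threshold for the penalty parameter. -/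

theorem exists_dominates (k : ℕ) (β₁ κ : ℝ) :
    ∃ βs : ℝ, 1 < βs ∧ (κ = 1 → 1 ≤ k → βs = max (Gam k β₁) (2 * Gam k 0)) ∧
      Dominates k β₁ κ βs := by
  -- For `κ = 1` only the ratio `t = 1` occurs; otherwise a bound comes from continuity on the
  -- compact range of ratios.
  have hmain : ∃ M : ℝ, (κ = 1 → M = Gam k β₁) ∧
      ∀ t, 0 < t → t ≤ (1 + κ) / 2 → (κ = 1 → t = 1) → t * Gam k (t * β₁) ≤ M := by
    by_cases hκ : κ = 1
    · refine ⟨Gam k β₁, fun _ => rfl, fun t _ _ ht => ?_⟩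
      rw [ht hκ, one_mul, one_mul]
    · have hcont : Continuous fun t : ℝ => t * Gam k (t * β₁) := by
        unfold Gam
        fun_prop
      obtain ⟨M, hM⟩ := (isCompact_Icc (a := (0 : ℝ)) (b := (1 + κ) / 2)).exists_bound_of_continuousOn
        hcont.continuousOn
      exact ⟨M, fun h => absurd h hκ, fun t ht0 ht _ =>
        (le_abs_self _).trans (hM t ⟨ht0.le, ht⟩)⟩
  obtain ⟨M, hM1, hM⟩ := hmain
  by_cases hk : 1 ≤ k
  · by_cases hκ : κ = 1
    · refine ⟨max (Gam k β₁) (2 * Gam k 0), ?_, fun _ _ => rfl, le_max_right _ _,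
        fun t h1 h2 h3 => (hM t h1 h2 h3).trans ((hM1 hκ).le.trans (le_max_left _ _))⟩
      refine lt_of_lt_of_le ?_ (le_max_right _ _)
      have : (1 : ℝ) ≤ k := by exact_mod_cast hk
      simp only [Gam]
      nlinarith
    · exact ⟨max 2 (max M (2 * Gam k 0)), lt_of_lt_of_le one_lt_two (le_max_left _ _),
        fun h => absurd h hκ, (le_max_right _ _).trans (le_max_right _ _), fun t h1 h2 h3 =>
          (hM t h1 h2 h3).trans ((le_max_left _ _).trans (le_max_right _ _))⟩
  · exact ⟨max 2 (max M (2 * Gam k 0)), lt_of_lt_of_le one_lt_two (le_max_left _ _),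
      fun _ h => absurd h hk, (le_max_right _ _).trans (le_max_right _ _), fun t h1 h2 h3 =>
        (hM t h1 h2 h3).trans ((le_max_left _ _).trans (le_max_right _ _))⟩

end RectMesh
end DDG

end

theorem theorem3p2 (n k : ℕ) (β₁ κ : ℝ) :
    ∃ βstar : ℝ, 1 < βstar ∧
      (κ = 1 → n + 1 ≤ 2 → 1 ≤ k → βstar = max (DDG.Gam k β₁) (2 * DDG.Gam k 0)) ∧
      ∀ β₀ : ℝ, βstar < β₀ →
        ∀ Ω : Set (Fin (n + 1) → ℝ), IsOpen Ω → IsConnected Ω → Bornology.IsBounded Ω →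
          ∀ ΓD : Set (Fin (n + 1) → ℝ), ΓD ⊆ frontier Ω → ΓD.Nonempty →
            ∃ C : ℝ, 0 < C ∧
              ∀ T : DDG.RectMesh Ω, T.RatioBound κ → T.Resolves ΓD →
                ∀ (m : ℕ) (q : Fin m → ℝ) (ρ₀ ψD σ : (Fin (n + 1) → ℝ) → ℝ),
                  IntegrableOn ρ₀ Ω → T.BoundaryIntegrable ΓD ψD →
                  T.BoundaryIntegrable (frontier Ω \ ΓD) σ →
                    (∀ c : Fin m → T.Space k,
                      ∃! ψ : T.Space k, DDG.RectMesh.IsSolution ΓD β₀ β₁ q ρ₀ ψD σ c ψ) ∧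
                    ∀ (c c' : Fin m → T.Space k) (ψ ψ' : T.Space k),
                      DDG.RectMesh.IsSolution ΓD β₀ β₁ q ρ₀ ψD σ c ψ →
                      DDG.RectMesh.IsSolution ΓD β₀ β₁ q ρ₀ ψD σ c' ψ' →
                        DDG.RectMesh.l2norm (ψ - ψ') ≤
                          C * ∑ i, |q i| * DDG.RectMesh.l2norm (c i - c' i) := by
  obtain ⟨βs, hβs, hsharp, hD⟩ := DDG.RectMesh.exists_dominates k β₁ κ
  refine ⟨βs, hβs, fun hκ _ hk => hsharp hκ hk, ?_⟩
  intro β₀ hβ₀ Ω hΩ hconn hbdd ΓD hΓ hne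
  -- `C` is chosen before the mesh. If no mesh resolves `ΓD`, any constant will do; otherwise one
  -- such mesh fixes the Poincaré constant and yields measurability of `ΓD`.
  by_cases hex : ∃ T₀ : DDG.RectMesh Ω, T₀.Resolves ΓD
  swap
  · exact ⟨1, one_pos, fun T _ hT => absurd ⟨T, hT⟩ hex⟩
  obtain ⟨T₀, hT₀⟩ := hex
  have hΓm : MeasurableSet ΓD := hT₀.measurableSet
  obtain ⟨C, hC, hpoin⟩ := DDG.RectMesh.exists_poincare hΩ hconn hbdd hΓm hΓ hne T₀ hT₀ k
  -- Any weight strictly between `βs` and `β₀` makes both `1 - βs / β'` and `β₀ - β'` positive.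
  set β' := (βs + β₀) / 2 with hβ'def
  have hβ' : 0 < β' := by linarith
  set γ := min (1 - βs / β') (β₀ - β')
  have hγ : 0 < γ := by
    refine lt_min (sub_pos.mpr ((div_lt_one hβ').mpr ?_)) ?_ <;> linarith
  -- The summand `1` only ensures strict positivity, as `C` is merely known to be nonnegative.
  refine ⟨C / γ + 1, by positivity, fun T hT _ m q ρ₀ ψD σ hρ hψD hσ => ?_⟩
  have hcoer : ∀ v : T.Space k, γ * DDG.RectMesh.energy ΓD v ≤ DDG.RectMesh.formA ΓD β₀ β₁ v v :=
    fun v => DDG.RectMesh.formA_self_ge hΩ hΓ hΓm hT hD hβ' (min_le_left _ _) (min_le_right _ _) v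
  refine ⟨fun c => DDG.RectMesh.existsUnique_isSolution hΓm (fun v hv => ?_) q hρ hψD hσ c,
    fun c c' ψ ψ' hψ hψ' => ?_⟩
  · have hE : DDG.RectMesh.energy ΓD v ≤ 0 := by
      have := hcoer v
      rw [hv] at this
      exact nonpos_of_mul_nonpos_right this hγ
    have hsq := (hpoin T v).trans (mul_nonpos_of_nonneg_of_nonpos hC hE)
    exact DDG.RectMesh.eq_zero_of_l2norm_eq_zero (pow_eq_zero_iff two_ne_zero |>.mp
      (le_antisymm hsq (sq_nonneg _)))
  · refine (DDG.RectMesh.isSolution_stable hγ hC hcoer (hpoin T) q hρ hψ hψ').trans ?_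
    have hN : 0 ≤ ∑ i, |q i| * DDG.RectMesh.l2norm (c i - c' i) :=
      Finset.sum_nonneg fun i _ => mul_nonneg (abs_nonneg _) (DDG.RectMesh.l2norm_nonneg _)
    exact mul_le_mul_of_nonneg_right (by linarith) hN
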